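/- Let $\rho>0$ and let $M=\mathbb S^1\times[-\rho,\rho]$ carry a smooth initial metric of the form $$g_0=d\sigma^2+f(\sigma)^2\,d\theta^2,\qquad \theta\in\mathbb R/2\pi\mathbb Z,\ \sigma\in[-\rho,\rho],\quad f>0 ,$$ which is symmetric under reflection in the middle parallel $\{\sigma=0\}$ (that is, $f(-\sigma)=f(\sigma)$), has nonnegative scalar curvature $R_{g_0}\ge 0$ (so that, by the symmetry, the geodesic curvature $k_{g_0}$ of $\partial M$ with respect to the outward normal is $\le 0$), and whose scalar curvature is decreasing from the middle: $R_{g_0}$ is nonincreasing in $|\sigma|$. Consider the Ricci flow with boundary condition $$\frac{\partial\tilde g}{\partial\tilde t}=-\tilde R\,\tilde g\ \text{ in } M\times(0,\tilde T),\qquad k_{\tilde g}=k_{g_0}\ \text{ on }\partial M\times(0,\tilde T),\qquad \tilde g(0)=g_0,$$ $0<\tilde T\le\infty$ (no symmetry of $\tilde g(\tilde t)$ for $\tilde t>0$ is assumed; $\tilde g$ is smooth on $M\times(0,\tilde T)$ up to $\partial M$, and is continuous down to $\tilde t=0$ together with its space derivatives of order at most two). The normalised flow is obtained from it by rescaling to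 unit area, $g=\phi\,\tilde g$ with $\phi(\tilde t)=1/A_{\tilde g(\tilde t)}(M)$, and by passing to the time $t=\int_0^{\tilde t}\phi(\tau)\,d\tau$; here $\tilde R$ and $R$ denote the scalar curvatures of $\tilde g$ and $g$. Let $g(t)$, $t\in[0,\infty)$, be a normalised flow obtained in this way, existing for all $t\ge 0$. Then there is a sequence of times $t_k\ge 0$, $t_k\to\infty$, such that $R(t_k)\to 0$ uniformly on $M$. -/

import Mathlib

open Set Filter Topology
open scoped ContDiff

noncomputable section

namespace CylinderFlow

/-- Coordinates `x 0 = θ` (of period `2π`) and `x 1 = σ ∈ [-ρ, ρ]` on the cylinder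
`M = 𝕊¹ × [-ρ, ρ]`; functions and tensors on `M` are `2π`-periodic in `θ`. -/
abbrev Coord : Type := Fin 2 → ℝ

/-- A field of `2 × 2` matrices: the components `g i j` of a covariant 2-tensor in the
coordinates `(θ, σ)`. -/
abbrev TensorField : Type := Coord → Matrix (Fin 2) (Fin 2) ℝ

/-- The closed strip that covers the cylinder. -/
def strip (ρ : ℝ) : Set Coord := {x | x 1 ∈ Icc (-ρ) ρ}

/-- Points of the strip that lie over the boundary of the cylinder. -/
def bdry (ρ : ℝ) : Set Coord := {x | x 1 = -ρ ∨ x 1 = ρ}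

/-- Partial derivative in the `i`-th coordinate (one-sided at the boundary). -/
def pd (ρ : ℝ) (i : Fin 2) (u : Coord → ℝ) (x : Coord) : ℝ :=
  fderivWithin ℝ u (strip ρ) x (Pi.single i 1)

/-- Christoffel symbol `Γᵏᵢⱼ` of the metric `g`. -/
def christoffel (ρ : ℝ) (g : TensorField) (k i j : Fin 2) (x : Coord) : ℝ :=
  (1 / 2) * ∑ l, (g x)⁻¹ k l *
    (pd ρ i (fun y => g y j l) x + pd ρ j (fun y => g y i l) x - pd ρ l (fun y => g y i j) x)

/-- Ricci tensor,
`Ricⱼₖ = ∂ᵢ Γⁱⱼₖ - ∂ⱼ Γⁱᵢₖ + Γⁱᵢₚ Γᵖⱼₖ - Γⁱⱼₚ Γᵖᵢₖ` (summed over `i`, `p`). -/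
def ricci (ρ : ℝ) (g : TensorField) (j k : Fin 2) (x : Coord) : ℝ :=
  ∑ i, (pd ρ i (christoffel ρ g i j k) x - pd ρ j (christoffel ρ g i i k) x +
    ∑ p, (christoffel ρ g i i p x * christoffel ρ g p j k x -
      christoffel ρ g i j p x * christoffel ρ g p i k x))

/-- Scalar curvature `R = gʲᵏ Ricⱼₖ` (twice the Gauss curvature). -/
def scalarCurvature (ρ : ℝ) (g : TensorField) (x : Coord) : ℝ :=
  ∑ j, ∑ k, (g x)⁻¹ j k * ricci ρ g j k x

/-- Geodesic curvature of the boundary at a point over `σ = ±ρ`, with respect to the outward unit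
normal `ν`: `k = -g(ν, ∇_T T)` with `T = ∂_θ / |∂_θ|` and `ν♭ = ± dσ / |dσ|`, so that
`k = ∓ Γ¹₀₀ / (g₀₀ √g¹¹)`. For `dσ² + f(σ)² dθ²` this is `± f' / f` at `σ = ±ρ`. -/
def geodesicCurvature (ρ : ℝ) (g : TensorField) (x : Coord) : ℝ :=
  -(Real.sign (x 1)) * christoffel ρ g 1 0 0 x / (g x 0 0 * √((g x)⁻¹ 1 1))

/-- Area of the cylinder. -/
def area (ρ : ℝ) (g : TensorField) : ℝ :=
  ∫ θ in (0 : ℝ)..(2 * Real.pi), ∫ σ in (-ρ)..ρ, √((g ![θ, σ]).det)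

/-- `g` is a (positive definite) metric on the cylinder. -/
def IsMetric (ρ : ℝ) (g : TensorField) : Prop :=
  ∀ x ∈ strip ρ, (g x).PosDef ∧ g (x + Pi.single 0 (2 * Real.pi)) = g x

/-- The rotationally symmetric metric `dσ² + f(σ)² dθ²`. -/
def rotMetric (f : ℝ → ℝ) : TensorField := fun x => !![f (x 1) ^ 2, 0; 0, 1]

/-- `g` solves on `M × [0, T)`, `0 < T ≤ ∞`, the boundary value problem for the (unnormalised)
Ricci flow: `∂g/∂t = -R g`, the geodesic curvature of the boundary stays that of `g₀`, and
`g = g₀` at `t = 0`. The solution is smooth up to the boundary for `t > 0`, and it is continuous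
down to `t = 0` together with its space derivatives of order at most two. -/
structure IsRicciFlow (ρ : ℝ) (g₀ : TensorField) (T : EReal) (g : ℝ → TensorField) : Prop where
  pos : 0 < T
  metric : ∀ t : ℝ, 0 ≤ t → (t : EReal) < T → IsMetric ρ (g t)
  smooth : ∀ i j, ContDiffOn ℝ ∞ (fun p : ℝ × Coord => g p.1 p.2 i j)
    {p | 0 < p.1 ∧ (p.1 : EReal) < T ∧ p.2 ∈ strip ρ}
  cont : ∀ i j, ContinuousOn (fun p : ℝ × Coord => g p.1 p.2 i j)
    {p | 0 ≤ p.1 ∧ (p.1 : EReal) < T ∧ p.2 ∈ strip ρ}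
  cont_pd : ∀ i j a, ContinuousOn (fun p : ℝ × Coord => pd ρ a (fun y => g p.1 y i j) p.2)
    {p | 0 ≤ p.1 ∧ (p.1 : EReal) < T ∧ p.2 ∈ strip ρ}
  cont_pd_pd : ∀ i j a b, ContinuousOn
    (fun p : ℝ × Coord => pd ρ b (pd ρ a (fun y => g p.1 y i j)) p.2)
    {p | 0 ≤ p.1 ∧ (p.1 : EReal) < T ∧ p.2 ∈ strip ρ}
  flow : ∀ t : ℝ, 0 < t → (t : EReal) < T → ∀ x ∈ strip ρ, ∀ i j,
    HasDerivAt (fun s => g s x i j) (-scalarCurvature ρ (g t) x * g t x i j) t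
  boundary : ∀ t : ℝ, 0 < t → (t : EReal) < T → ∀ x ∈ bdry ρ,
    geodesicCurvature ρ (g t) x = geodesicCurvature ρ g₀ x
  initial : ∀ x ∈ strip ρ, g 0 x = g₀ x

/-- The factor `φ` that rescales the unnormalised flow `g'` to unit area. -/
def normFactor (ρ : ℝ) (g' : ℝ → TensorField) (t' : ℝ) : ℝ := 1 / area ρ (g' t')

/-- The rescaled time `t(t') = ∫₀^{t'} φ`. -/
def normTime (ρ : ℝ) (g' : ℝ → TensorField) (t' : ℝ) : ℝ :=
  ∫ τ in (0 : ℝ)..t', normFactor ρ g' τ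

/-- `g`, on `M × [0, ∞)`, is the normalised flow with initial data `g₀`: it comes from a solution
`g'` on `M × [0, T)`, `0 < T ≤ ∞`, of the unnormalised flow by rescaling to unit area,
`g = φ g'`, and by passing from the time `t'` to the time `t = ∫₀^{t'} φ`, which takes every
value in `[0, ∞)`. -/
def IsNormalisedFlow (ρ : ℝ) (g₀ : TensorField) (g : ℝ → TensorField) : Prop :=
  ∃ (T : EReal) (g' : ℝ → TensorField), IsRicciFlow ρ g₀ T g' ∧
    ∀ t : ℝ, 0 ≤ t → ∃ t' : ℝ, 0 ≤ t' ∧ (t' : EReal) < T ∧ normTime ρ g' t' = t ∧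
      ∀ x ∈ strip ρ, g t x = normFactor ρ g' t' • g' t' x

end CylinderFlow

end

/-! The Ricci flow on a surface is conformal, so with the isothermal coordinate `ds = dσ / f` the
unnormalised metric is `v⁻² (dθ² + ds²)` for a positive function `v` with `v = 1 / f` initially. The
flow becomes `v_t = v² Δv - v |∇v|²`, the scalar curvature is `2 (v Δv - |∇v|²)`, and prescribing
the geodesic curvature is the linear Neumann condition `v_s = ±κ` at `σ = ±ρ`, where `-κ` is the
curvature of the boundary. Nonnegative curvature makes `f` concave, and evenness then gives `κ ≥ 0`.

Everything else is the maximum principle `max_principle` applied to `v` and its derivatives.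
Comparison with rotations (`IsSol.le_rotate`) shows that `v` depends on `s` and `t` only. Then `v_s`
is bounded (`IsSol.abs_sd_le`), hence so is the oscillation of `v` (`IsSol.sub_le`), and `v_ss` is
bounded (`IsSol.abs_sd_sd_le`), all with constants that depend on the initial data only.

If `κ = 0` the initial metric is a flat cylinder and `v_s` stays zero. If `κ > 0`, a quadratic
barrier forces `v` to grow at least linearly in the unnormalised time (`IsProfile.exists_growth`).
While `v` is bounded the area is bounded below, so the normalised clock can advance by a bounded
amount only; large normalised time therefore means large `v` (`le_of_normTime`). When `v` has size
`V` throughout, the area is of order `V⁻²` and the unnormalised curvature is at most of order `V`,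
so the normalised curvature, their product, is at most of order `1 / V`. This yields uniform decay
as `t → ∞`, and any sequence of times tending to infinity will do. -/

namespace CylinderFlow

variable {ρ : ℝ}

/-! ### Calculus on the strip and on the space-time slab, up to the boundary. -/

theorem isOpen_open_strip : IsOpen {x : Coord | x 1 ∈ Ioo (-ρ) ρ} :=
  isOpen_Ioo.preimage (continuous_apply 1)

theorem convex_strip : Convex ℝ (strip ρ) :=
  (convex_Icc (-ρ) ρ).is_linear_preimage (f := fun x : Coord => x 1) ⟨fun _ _ => rfl, fun _ _ => rfl⟩

theorem interior_strip_nonempty (hρ : 0 < ρ) : (interior (strip ρ)).Nonempty := by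
  refine ⟨0, mem_interior.2 ⟨{x : Coord | x 1 ∈ Ioo (-ρ) ρ}, fun x hx => Ioo_subset_Icc_self hx,
    isOpen_open_strip, ?_⟩⟩
  simp [hρ]

theorem uniqueDiffOn_strip (hρ : 0 < ρ) : UniqueDiffOn ℝ (strip ρ) :=
  uniqueDiffOn_convex convex_strip (interior_strip_nonempty hρ)

theorem add_single_zero_mem_strip {x : Coord} (a : ℝ) (hx : x ∈ strip ρ) :
    x + Pi.single 0 a ∈ strip ρ := by
  simpa [strip] using hx

/-- The space-time region over which a flow on `(0, T)` is smooth. -/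
def slab (ρ T : ℝ) : Set (ℝ × Coord) := Ioo 0 T ×ˢ strip ρ

/-- Smoothness in time and space together, up to the boundary of the cylinder. -/
def JointSmooth (ρ T : ℝ) (u : ℝ → Coord → ℝ) : Prop :=
  ContDiffOn ℝ ∞ (fun p : ℝ × Coord => u p.1 p.2) (slab ρ T)

theorem convex_slab {T : ℝ} : Convex ℝ (slab ρ T) := (convex_Ioo 0 T).prod convex_strip

theorem interior_slab_nonempty {T : ℝ} (hρ : 0 < ρ) (hT : 0 < T) :
    (interior (slab ρ T)).Nonempty := by
  rw [slab, interior_prod_eq, interior_Ioo]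
  exact (nonempty_Ioo.2 hT).prod (interior_strip_nonempty hρ)

theorem uniqueDiffOn_slab {T : ℝ} (hρ : 0 < ρ) (hT : 0 < T) : UniqueDiffOn ℝ (slab ρ T) :=
  uniqueDiffOn_convex convex_slab (interior_slab_nonempty hρ hT)

theorem slab_subset_closure_interior {T : ℝ} (hρ : 0 < ρ) (hT : 0 < T) :
    slab ρ T ⊆ closure (interior (slab ρ T)) := by
  rw [convex_slab.closure_interior_eq_closure_of_nonempty_interior (interior_slab_nonempty hρ hT)]
  exact subset_closure

theorem pd_congr {u w : Coord → ℝ} (h : ∀ y ∈ strip ρ, u y = w y) {x : Coord} (hx : x ∈ strip ρ)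
    (i : Fin 2) : pd ρ i u x = pd ρ i w x := by
  unfold pd
  rw [fderivWithin_congr (fun y hy => h y hy) (h x hx)]

theorem pd_const (i : Fin 2) (c : ℝ) (x : Coord) : pd ρ i (fun _ => c) x = 0 := by
  simp [pd]

section Rules

variable {u w : Coord → ℝ} {x : Coord}

theorem pd_add (hρ : 0 < ρ) (hx : x ∈ strip ρ) (i : Fin 2)
    (hu : DifferentiableWithinAt ℝ u (strip ρ) x) (hw : DifferentiableWithinAt ℝ w (strip ρ) x) :
    pd ρ i (fun y => u y + w y) x = pd ρ i u x + pd ρ i w x := by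
  unfold pd
  rw [fderivWithin_fun_add (uniqueDiffOn_strip hρ x hx) hu hw]; rfl

theorem pd_sub (hρ : 0 < ρ) (hx : x ∈ strip ρ) (i : Fin 2)
    (hu : DifferentiableWithinAt ℝ u (strip ρ) x) (hw : DifferentiableWithinAt ℝ w (strip ρ) x) :
    pd ρ i (fun y => u y - w y) x = pd ρ i u x - pd ρ i w x := by
  unfold pd
  rw [fderivWithin_fun_sub (uniqueDiffOn_strip hρ x hx) hu hw]; rfl

theorem pd_neg (hρ : 0 < ρ) (hx : x ∈ strip ρ) (i : Fin 2) :
    pd ρ i (fun y => - u y) x = - pd ρ i u x := by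
  unfold pd
  rw [fderivWithin_fun_neg (uniqueDiffOn_strip hρ x hx)]; rfl

theorem pd_mul (hρ : 0 < ρ) (hx : x ∈ strip ρ) (i : Fin 2)
    (hu : DifferentiableWithinAt ℝ u (strip ρ) x) (hw : DifferentiableWithinAt ℝ w (strip ρ) x) :
    pd ρ i (fun y => u y * w y) x = pd ρ i u x * w x + u x * pd ρ i w x := by
  unfold pd
  rw [fderivWithin_fun_mul (uniqueDiffOn_strip hρ x hx) hu hw]
  simp; ring

theorem pd_comp (hρ : 0 < ρ) (hx : x ∈ strip ρ) (i : Fin 2) {ψ : ℝ → ℝ} {c : ℝ}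
    (hψ : HasDerivAt ψ c (u x)) (hu : DifferentiableWithinAt ℝ u (strip ρ) x) :
    pd ρ i (fun y => ψ (u y)) x = c * pd ρ i u x := by
  unfold pd
  have h := (hψ.comp_hasFDerivWithinAt x hu.hasFDerivWithinAt).fderivWithin
    (uniqueDiffOn_strip hρ x hx)
  have e : (fun y => ψ (u y)) = ψ ∘ u := rfl
  rw [e, h]; simp

theorem contDiffOn_pd (hρ : 0 < ρ) (hu : ContDiffOn ℝ ∞ u (strip ρ)) (i : Fin 2) :
    ContDiffOn ℝ ∞ (pd ρ i u) (strip ρ) :=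
  (hu.fderivWithin (uniqueDiffOn_strip hρ) (by simp)).clm_apply contDiffOn_const

theorem pd_comp_add (i : Fin 2) (u : Coord → ℝ) (a : ℝ) (x : Coord) :
    pd ρ i (fun y => u (y + Pi.single 0 a)) x = pd ρ i u (x + Pi.single 0 a) := by
  unfold pd
  rw [fderivWithin_comp_add_right]
  congr 2
  ext y
  simp [mem_vadd_set_iff_neg_vadd_mem, strip]

end Rules

section Joint

variable {T : ℝ} {u : ℝ → Coord → ℝ}

theorem JointSmooth.slice (hu : JointSmooth ρ T u) {t : ℝ} (ht : t ∈ Ioo 0 T) :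
    ContDiffOn ℝ ∞ (u t) (strip ρ) := by
  have : ContDiffOn ℝ ∞ (fun y : Coord => (t, y)) (strip ρ) :=
    (contDiff_const.prodMk contDiff_id).contDiffOn
  exact ContDiffOn.comp (g := fun p : ℝ × Coord => u p.1 p.2) hu this (fun y hy => ⟨ht, hy⟩)

/-- Expressing a space derivative through the joint derivative lets smoothness in all variables, and
the symmetry of second derivatives, pass to `pd`. -/
theorem pd_eq_fderivWithin_slab (hρ : 0 < ρ) {t : ℝ} {x : Coord}
    (hu : DifferentiableWithinAt ℝ (fun p : ℝ × Coord => u p.1 p.2) (slab ρ T) (t, x))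
    (ht : t ∈ Ioo 0 T) (hx : x ∈ strip ρ) (i : Fin 2) :
    pd ρ i (u t) x =
      fderivWithin ℝ (fun p : ℝ × Coord => u p.1 p.2) (slab ρ T) (t, x) (0, Pi.single i 1) := by
  have h1 : HasFDerivWithinAt (fun y : Coord => (t, y)) (ContinuousLinearMap.inr ℝ ℝ Coord)
      (strip ρ) x := (hasFDerivAt_prodMk_right t x).hasFDerivWithinAt
  have h2 := hu.hasFDerivWithinAt.comp x h1 (fun y hy => (⟨ht, hy⟩ : (t, y) ∈ slab ρ T))
  have h3 := h2.fderivWithin (uniqueDiffOn_strip hρ x hx)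
  unfold pd
  have e : u t = (fun p : ℝ × Coord => u p.1 p.2) ∘ (fun y : Coord => (t, y)) := rfl
  rw [e, h3]; simp

/-- The time interval is open, so restricting to the slab costs nothing in the time direction: the
derivative is two-sided even at boundary points of the cylinder. -/
theorem hasDerivAt_fderivWithin_slab {t : ℝ} {x : Coord} {F : Type*} [NormedAddCommGroup F]
    [NormedSpace ℝ F] {U : ℝ × Coord → F}
    (hu : DifferentiableWithinAt ℝ U (slab ρ T) (t, x)) (ht : t ∈ Ioo 0 T) (hx : x ∈ strip ρ) :
    HasDerivAt (fun s => U (s, x)) (fderivWithin ℝ U (slab ρ T) (t, x) (1, 0)) t := by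
  have h1 : HasDerivWithinAt (fun s : ℝ => (s, x)) ((1 : ℝ), (0 : Coord)) (Ioo 0 T) t :=
    ((hasDerivAt_id t).prodMk (hasDerivAt_const t x)).hasDerivWithinAt
  have h2 := hu.hasFDerivWithinAt.comp_hasDerivWithinAt t h1
    (fun s hs => (⟨hs, hx⟩ : (s, x) ∈ slab ρ T))
  exact h2.hasDerivAt (Ioo_mem_nhds ht.1 ht.2)

theorem JointSmooth.pd (hρ : 0 < ρ) (hT : 0 < T) (hu : JointSmooth ρ T u) (i : Fin 2) :
    JointSmooth ρ T (fun t => pd ρ i (u t)) := by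
  have h : ContDiffOn ℝ ∞ (fun p => fderivWithin ℝ (fun p : ℝ × Coord => u p.1 p.2) (slab ρ T) p
      ((0 : ℝ), (Pi.single i 1 : Coord))) (slab ρ T) :=
    (hu.fderivWithin (uniqueDiffOn_slab hρ hT) (by simp)).clm_apply contDiffOn_const
  refine h.congr fun p hp => ?_
  exact pd_eq_fderivWithin_slab hρ (hu.differentiableOn (by simp) p hp) hp.1 hp.2 i

/-- Time and space derivatives commute. -/
theorem JointSmooth.hasDerivAt_pd (hρ : 0 < ρ) (hu : JointSmooth ρ T u)
    {t : ℝ} (ht : t ∈ Ioo 0 T) {u' : Coord → ℝ}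
    (hu' : ∀ y ∈ strip ρ, HasDerivAt (fun s => u s y) (u' y) t) {x : Coord} (hx : x ∈ strip ρ)
    (i : Fin 2) :
    HasDerivAt (fun s => CylinderFlow.pd ρ i (u s) x) (CylinderFlow.pd ρ i u' x) t := by
  have hT : 0 < T := ht.1.trans ht.2
  set U : ℝ × Coord → ℝ := fun p => u p.1 p.2 with hU
  have hmem : (t, x) ∈ slab ρ T := ⟨ht, hx⟩
  have hF : ContDiffOn ℝ ∞ (fderivWithin ℝ U (slab ρ T)) (slab ρ T) :=
    hu.fderivWithin (uniqueDiffOn_slab hρ hT) (by simp)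
  have hFd := hF.differentiableOn (by simp) (t, x) hmem
  -- Symmetry of the second derivative is available at boundary points too, because the slab lies in
  -- the closure of its interior.
  have hsymm : IsSymmSndFDerivWithinAt ℝ U (slab ρ T) (t, x) :=
    ContDiffWithinAt.isSymmSndFDerivWithinAt (hu (t, x) hmem)
      (by rw [minSmoothness_of_isRCLikeNormedField]; norm_cast)
      (uniqueDiffOn_slab hρ hT)
      (slab_subset_closure_interior hρ hT hmem) hmem
  have h1 := hasDerivAt_fderivWithin_slab hFd ht hx
  have h2 := h1.clm_apply (hasDerivAt_const t ((0 : ℝ), (Pi.single i 1 : Coord)))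
  have h3 : HasDerivAt (fun s => CylinderFlow.pd ρ i (u s) x)
      (fderivWithin ℝ (fderivWithin ℝ U (slab ρ T)) (slab ρ T) (t, x) (1, 0)
        (0, Pi.single i 1)) t := by
    have h4 : (fun s => CylinderFlow.pd ρ i (u s) x) =ᶠ[𝓝 t]
        fun s => fderivWithin ℝ U (slab ρ T) (s, x) (0, Pi.single i 1) := by
      filter_upwards [Ioo_mem_nhds ht.1 ht.2] with s hs
      exact pd_eq_fderivWithin_slab hρ (hu.differentiableOn (by simp) (s, x) ⟨hs, hx⟩) hs hx i
    refine HasDerivAt.congr_of_eventuallyEq ?_ h4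
    simpa using h2
  convert h3 using 1
  rw [hsymm (1, 0) (0, Pi.single i 1)]
  have h5 : CylinderFlow.pd ρ i u' x =
      CylinderFlow.pd ρ i (fun y => fderivWithin ℝ U (slab ρ T) (t, y) (1, 0)) x := by
    refine pd_congr (fun y hy => ?_) hx i
    exact (hu' y hy).unique (hasDerivAt_fderivWithin_slab
      (hu.differentiableOn (by simp) (t, y) ⟨ht, hy⟩) ht hy)
  have hG : ContDiffOn ℝ ∞ (fun p => fderivWithin ℝ U (slab ρ T) p ((1 : ℝ), (0 : Coord)))
      (slab ρ T) := hF.clm_apply contDiffOn_const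
  rw [h5, pd_eq_fderivWithin_slab (T := T)
    (u := fun s y => fderivWithin ℝ U (slab ρ T) (s, y) (1, 0)) hρ
    (hG.differentiableOn (by simp) (t, x) hmem) ht hx i]
  have h6 : (fderivWithin ℝ (fun p : ℝ × Coord =>
      fderivWithin ℝ U (slab ρ T) (p.1, p.2) ((1 : ℝ), (0 : Coord))) (slab ρ T) (t, x)) = _ :=
    (hFd.hasFDerivWithinAt.clm_apply
    (hasFDerivWithinAt_const ((1 : ℝ), (0 : Coord)) (t, x) (slab ρ T))).fderivWithin
      (uniqueDiffOn_slab hρ hT _ hmem)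
  rw [h6]
  simp

end Joint

/-! ### Derivative tests at a maximum and the parabolic maximum principle. -/

section Maximum

/-- One-sided second derivative test at a maximum. -/
theorem second_deriv_nonpos_of_max {φ φ₁ : ℝ → ℝ} {δ c : ℝ} (hδ : 0 < δ)
    (h₁ : ∀ h ∈ Icc 0 δ, HasDerivWithinAt φ (φ₁ h) (Icc 0 δ) h)
    (hmax : ∀ h ∈ Icc 0 δ, φ h ≤ φ 0) :
    φ₁ 0 ≤ 0 ∧ (φ₁ 0 = 0 → HasDerivWithinAt φ₁ c (Icc 0 δ) 0 → c ≤ 0) := by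
  have h0 : (0 : ℝ) ∈ Icc 0 δ := ⟨le_rfl, hδ.le⟩
  have key : ∀ {ψ : ℝ → ℝ} {d : ℝ}, HasDerivWithinAt ψ d (Icc 0 δ) 0 → 0 < d →
      ∀ᶠ h in 𝓝[>] (0 : ℝ), ψ 0 < ψ h := by
    intro ψ d hψ hd
    have h2 : HasDerivWithinAt ψ d (Ioi 0) 0 :=
      hψ.mono_of_mem_nhdsWithin (Icc_mem_nhdsGT hδ)
    rw [hasDerivWithinAt_iff_tendsto_slope' (by simp)] at h2
    filter_upwards [h2.eventually (lt_mem_nhds hd), self_mem_nhdsWithin] with h hh hp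
    rw [slope_def_field] at hh
    have hp' : (0 : ℝ) < h - 0 := by simpa using hp
    have := (div_pos_iff_of_pos_right hp').1 hh
    linarith
  refine ⟨?_, fun hz hc => ?_⟩
  · by_contra hcon
    push Not at hcon
    obtain ⟨h, hlt, hm⟩ := ((key (h₁ 0 h0) hcon).and (Icc_mem_nhdsGT hδ)).exists
    exact absurd (hmax h hm) (not_le.2 hlt)
  · by_contra hcon
    push Not at hcon
    have hev := key hc hcon
    obtain ⟨ε, hε, hsub⟩ := mem_nhdsGT_iff_exists_Ioo_subset.1 hev
    set η := min (ε / 2) δ with hη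
    have hε' : 0 < ε := hε
    have hηp : 0 < η := lt_min (by linarith) hδ
    -- If `c > 0` and `φ₁ 0 = 0`, then `φ₁ > 0` just after `0`, so `φ` would increase strictly away
    -- from its maximum.
    have hmono : StrictMonoOn φ (Icc 0 η) := by
      refine strictMonoOn_of_deriv_pos (convex_Icc _ _) ?_ ?_
      · intro h hh
        exact ((h₁ h ⟨hh.1, hh.2.trans (min_le_right _ _)⟩).continuousWithinAt).mono
          (Icc_subset_Icc le_rfl (min_le_right _ _))
      · intro h hh
        rw [interior_Icc] at hh
        have hd := (h₁ h ⟨hh.1.le, hh.2.le.trans (min_le_right _ _)⟩).hasDerivAt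
          (Icc_mem_nhds hh.1 (hh.2.trans_le (min_le_right _ _)))
        rw [hd.deriv]
        have : φ₁ 0 < φ₁ h := hsub ⟨hh.1, by linarith [hh.2, min_le_left (ε / 2) δ]⟩
        linarith
    have := hmono (left_mem_Icc.2 hηp.le) (right_mem_Icc.2 hηp.le) hηp
    exact absurd (hmax η ⟨hηp.le, min_le_right _ _⟩) (not_le.2 this)

/-- Second derivative test at a maximum over the strip, along a direction into the strip. -/
theorem directional_max_test (hρ : 0 < ρ) {u : Coord → ℝ} (hu : ContDiffOn ℝ ∞ u (strip ρ))
    {x : Coord} (hmax : IsMaxOn u (strip ρ) x) (e : Coord) {δ : ℝ} (hδ : 0 < δ)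
    (hin : ∀ h ∈ Icc 0 δ, x + h • e ∈ strip ρ) :
    fderivWithin ℝ u (strip ρ) x e ≤ 0 ∧ (fderivWithin ℝ u (strip ρ) x e = 0 →
      fderivWithin ℝ (fun y => fderivWithin ℝ u (strip ρ) y e) (strip ρ) x e ≤ 0) := by
  have hline : ∀ {w : Coord → ℝ}, DifferentiableOn ℝ w (strip ρ) → ∀ h ∈ Icc 0 δ,
      HasDerivWithinAt (fun h : ℝ => w (x + h • e)) (fderivWithin ℝ w (strip ρ) (x + h • e) e)
        (Icc 0 δ) h := by
    intro w hw h hh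
    have h1 : HasDerivWithinAt (fun h : ℝ => x + h • e) e (Icc 0 δ) h := by
      simpa using (((hasDerivAt_id h).smul_const e).const_add x).hasDerivWithinAt
    exact (hw _ (hin h hh)).hasFDerivWithinAt.comp_hasDerivWithinAt h h1 hin
  have hd1 : ContDiffOn ℝ ∞ (fun y => fderivWithin ℝ u (strip ρ) y e) (strip ρ) :=
    (hu.fderivWithin (uniqueDiffOn_strip hρ) (by simp)).clm_apply contDiffOn_const
  have hm : ∀ h ∈ Icc 0 δ, u (x + h • e) ≤ u (x + (0 : ℝ) • e) := by
    intro h hh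
    simpa using hmax (hin h hh)
  have := second_deriv_nonpos_of_max
    (c := fderivWithin ℝ (fun y => fderivWithin ℝ u (strip ρ) y e) (strip ρ) (x + (0 : ℝ) • e) e)
    hδ (hline (hu.differentiableOn (by simp))) hm
  refine ⟨by simpa using this.1, fun h0 => ?_⟩
  simpa using this.2 (by simpa using h0)
    (hline (hd1.differentiableOn (by simp)) 0 ⟨le_rfl, hδ.le⟩)

/-- At the upper boundary only the negative direction points into the strip; in the second
derivative the two signs cancel. -/
theorem fderivWithin_neg_single_neg_single (hρ : 0 < ρ) (u : Coord → ℝ)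
    {x : Coord} (hx : x ∈ strip ρ) (i : Fin 2) :
    fderivWithin ℝ (fun y => fderivWithin ℝ u (strip ρ) y (-Pi.single i 1)) (strip ρ) x
      (-Pi.single i 1) = pd ρ i (pd ρ i u) x := by
  have : (fun y => fderivWithin ℝ u (strip ρ) y (-Pi.single i 1)) = fun y => -(pd ρ i u y) := by
    funext y; simp [pd]
  rw [this, fderivWithin_fun_neg (uniqueDiffOn_strip hρ x hx)]
  simp [pd]

/-- Both signs of the `θ` direction are admissible, so the tangential derivative vanishes. In the
`σ` direction only inward directions are, so at the boundary the first derivative has a sign and the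
second-order conclusion needs it to vanish. -/
theorem pd_max_test (hρ : 0 < ρ) {u : Coord → ℝ} (hu : ContDiffOn ℝ ∞ u (strip ρ))
    {x : Coord} (hx : x ∈ strip ρ) (hmax : IsMaxOn u (strip ρ) x) :
    (pd ρ 0 u x = 0 ∧ pd ρ 0 (pd ρ 0 u) x ≤ 0) ∧ (x 1 < ρ → pd ρ 1 u x ≤ 0) ∧
      (-ρ < x 1 → 0 ≤ pd ρ 1 u x) ∧ (pd ρ 1 u x = 0 → pd ρ 1 (pd ρ 1 u) x ≤ 0) := by
  have hp : x 1 < ρ → ∀ h ∈ Icc 0 (ρ - x 1), x + h • (Pi.single 1 1 : Coord) ∈ strip ρ := by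
    intro _ h hh
    have h1 := hx.1
    have h2 := hh.1
    have h3 := hh.2
    simp only [strip, mem_ofPred_eq, Pi.add_apply, Pi.smul_apply, Pi.single_eq_same, smul_eq_mul,
      mul_one, mem_Icc]
    constructor <;> linarith
  have hm : -ρ < x 1 → ∀ h ∈ Icc 0 (x 1 + ρ), x + h • (-Pi.single 1 1 : Coord) ∈ strip ρ := by
    intro _ h hh
    have h1 := hx.2
    have h2 := hh.1
    have h3 := hh.2
    simp only [strip, mem_ofPred_eq, Pi.add_apply, Pi.smul_apply, Pi.single_eq_same, smul_eq_mul,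
      Pi.neg_apply, mul_neg, mul_one, mem_Icc]
    constructor <;> linarith
  have h0p : ∀ h ∈ Icc (0 : ℝ) 1, x + h • (Pi.single 0 1 : Coord) ∈ strip ρ := by
    intro h _
    simpa [strip] using hx
  have h0m : ∀ h ∈ Icc (0 : ℝ) 1, x + h • (-Pi.single 0 1 : Coord) ∈ strip ρ := by
    intro h _
    simpa [strip] using hx
  have a1 := directional_max_test hρ hu hmax _ one_pos h0p
  have a2 := directional_max_test hρ hu hmax _ one_pos h0m
  have e0 : pd ρ 0 u x = 0 := by
    have := a2.1
    rw [map_neg] at this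
    unfold pd
    linarith [a1.1]
  refine ⟨⟨e0, a1.2 e0⟩, fun h => ?_, fun h => ?_, fun h => ?_⟩
  · exact (directional_max_test hρ hu hmax _ (sub_pos.2 h) (hp h)).1
  · have := (directional_max_test hρ hu hmax _ (by linarith) (hm h)).1
    rw [map_neg] at this
    unfold pd
    linarith
  · rcases lt_or_ge (x 1) ρ with h' | h'
    · exact (directional_max_test hρ hu hmax _ (sub_pos.2 h') (hp h')).2 h
    · have h'' : -ρ < x 1 := by linarith
      rw [← fderivWithin_neg_single_neg_single hρ u hx]
      exact (directional_max_test hρ hu hmax _ (by linarith) (hm h'')).2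
        (by rw [map_neg]; simpa [pd] using h)

/-- A representative in the fundamental domain of a point of the strip. -/
theorem exists_mem_fundamental (x : Coord) (hx : x ∈ strip ρ) :
    ∃ y ∈ Icc (![0, -ρ] : Coord) ![2 * Real.pi, ρ],
      ∀ u : Coord → ℝ, (∀ z ∈ strip ρ, u (z + Pi.single 0 (2 * Real.pi)) = u z) → u y = u x := by
  have hpi : 0 < 2 * Real.pi := by positivity
  have hint : ∀ u : Coord → ℝ, (∀ z ∈ strip ρ, u (z + Pi.single 0 (2 * Real.pi)) = u z) →
      ∀ n : ℕ, ∀ z ∈ strip ρ, u (z + Pi.single 0 (n * (2 * Real.pi))) = u z := by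
    intro u hu n
    induction n with
    | zero => intro z _; simp
    | succ k ih =>
      intro z hz
      rw [← ih z hz]
      refine Eq.trans ?_ (hu _ (add_single_zero_mem_strip _ hz))
      rw [add_assoc, ← Pi.single_add]
      congr 3
      push_cast; ring
  set n := toIcoDiv hpi 0 (x 0) with hn
  set s := toIcoMod hpi 0 (x 0) with hs
  have hsn : x 0 = s + n * (2 * Real.pi) := by
    have := toIcoMod_add_toIcoDiv_zsmul hpi 0 (x 0)
    rw [zsmul_eq_mul] at this
    exact this.symm
  have hsm : s ∈ Ico (0 : ℝ) (0 + 2 * Real.pi) := toIcoMod_mem_Ico hpi 0 (x 0)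
  refine ⟨![s, x 1], ⟨?_, ?_⟩, ?_⟩
  · intro i; fin_cases i
    · exact hsm.1
    · exact hx.1
  · intro i; fin_cases i
    · simpa using hsm.2.le
    · exact hx.2
  · intro u hu
    have hy : (![s, x 1] : Coord) ∈ strip ρ := hx
    -- Only forward translates are at hand; for negative `n` the translation is made from the other
    -- point.
    rcases le_total 0 n with h | h
    · lift n to ℕ using h with m hm
      rw [← hint u hu m _ hy]
      congr 1
      ext i; fin_cases i
      · simp [hsn]
      · simp
    · obtain ⟨m, hm⟩ := Int.exists_eq_neg_ofNat h
      rw [← hint u hu m _ hx]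
      congr 1
      ext i; fin_cases i
      · simp [hsn, hm]
      · simp

theorem fundamental_subset_strip : Icc (![0, -ρ] : Coord) ![2 * Real.pi, ρ] ⊆ strip ρ :=
  fun _ hy => ⟨hy.1 1, hy.2 1⟩

theorem fundamental_nonempty (hρ : 0 < ρ) :
    (Icc (![0, -ρ] : Coord) ![2 * Real.pi, ρ]).Nonempty := by
  refine nonempty_Icc.2 fun i => ?_
  fin_cases i
  · simp [Real.pi_pos.le]
  · simp [hρ.le]

/-- The strip is not compact, but periodicity reduces the bound to the fundamental rectangle, which
is. -/
theorem exists_bound_of_continuousOn {a b : ℝ} {z : ℝ → Coord → ℝ}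
    (hcont : ContinuousOn (fun p : ℝ × Coord => z p.1 p.2) (Icc a b ×ˢ strip ρ))
    (hper : ∀ t ∈ Icc a b, ∀ x ∈ strip ρ, z t (x + Pi.single 0 (2 * Real.pi)) = z t x) :
    ∃ C, 0 < C ∧ ∀ t ∈ Icc a b, ∀ x ∈ strip ρ, |z t x| ≤ C := by
  obtain ⟨C, hC⟩ := (isCompact_Icc.prod isCompact_Icc).exists_bound_of_continuousOn
    (hcont.mono (prod_mono_right fundamental_subset_strip))
  refine ⟨max C 1, by positivity, fun t ht x hx => ?_⟩
  obtain ⟨y, hy, hyx⟩ := exists_mem_fundamental x hx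
  rw [← hyx (z t) (hper t ht)]
  exact (hC (t, y) ⟨ht, hy⟩).trans (le_max_left _ _)

/-- The maximum principle: a function whose time derivative is nonpositive at its spatial maxima
stays below its initial bound. -/
theorem max_principle (hρ : 0 < ρ) {a b M : ℝ} {z : ℝ → Coord → ℝ}
    (hcont : ContinuousOn (fun p : ℝ × Coord => z p.1 p.2) (Icc a b ×ˢ strip ρ))
    (hper : ∀ t ∈ Icc a b, ∀ x ∈ strip ρ, z t (x + Pi.single 0 (2 * Real.pi)) = z t x)
    (hinit : ∀ x ∈ strip ρ, z a x ≤ M)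
    (hdec : ∀ t ∈ Ioc a b, ∀ x ∈ strip ρ, IsMaxOn (z t) (strip ρ) x → M < z t x →
      ∃ z' ≤ 0, HasDerivAt (fun s => z s x) z' t) :
    ∀ t ∈ Icc a b, ∀ x ∈ strip ρ, z t x ≤ M := by
  intro t₁ ht₁ x₁ hx₁
  have hab : a ≤ b := ht₁.1.trans ht₁.2
  -- Subtracting `ε (t - a)` makes the time derivative strictly negative at a maximum of the
  -- modified function that is later than `a`, whereas the difference quotients from the left there
  -- are nonnegative.
  have main : ∀ ε > 0, z t₁ x₁ - ε * (t₁ - a) ≤ M := by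
    intro ε hε
    set K := Icc a b ×ˢ Icc (![0, -ρ] : Coord) ![2 * Real.pi, ρ]
    have hK : IsCompact K := isCompact_Icc.prod isCompact_Icc
    have hKn : K.Nonempty := (nonempty_Icc.2 hab).prod (fundamental_nonempty hρ)
    have hc : ContinuousOn (fun p : ℝ × Coord => z p.1 p.2 - ε * (p.1 - a)) K :=
      (hcont.mono (prod_mono_right fundamental_subset_strip)).sub (by fun_prop)
    obtain ⟨⟨t₀, x₀⟩, hmem, hmax⟩ := hK.exists_isMaxOn hKn hc
    have hall : ∀ t ∈ Icc a b, ∀ x ∈ strip ρ, z t x - ε * (t - a) ≤ z t₀ x₀ - ε * (t₀ - a) := by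
      intro t ht x hx
      obtain ⟨y, hy, hyx⟩ := exists_mem_fundamental x hx
      rw [← hyx (z t) (hper t ht)]
      exact hmax (show (t, y) ∈ K from ⟨ht, hy⟩)
    refine (hall t₁ ht₁ x₁ hx₁).trans ?_
    have hx₀ : x₀ ∈ strip ρ := fundamental_subset_strip hmem.2
    have ht₀ : t₀ ∈ Icc a b := hmem.1
    by_contra hcon
    push Not at hcon
    have hta : a < t₀ := by
      refine lt_of_le_of_ne ht₀.1 fun h => ?_
      rw [← h] at hcon
      have := hinit x₀ hx₀
      linarith
    obtain ⟨z', hz', hd⟩ := hdec t₀ ⟨hta, ht₀.2⟩ x₀ hx₀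
      (fun x hx => by
        have := hall t₀ ht₀ x hx
        simp only [mem_ofPred_eq]
        linarith) (by nlinarith)
    have hd2 : HasDerivWithinAt (fun s => z s x₀ - ε * (s - a)) (z' - ε * 1) (Iio t₀) t₀ :=
      (hd.sub (((hasDerivAt_id t₀).sub_const a).const_mul ε)).hasDerivWithinAt
    rw [hasDerivWithinAt_iff_tendsto_slope' (by simp)] at hd2
    have hev := hd2.eventually (gt_mem_nhds (show z' - ε * 1 < 0 by linarith))
    obtain ⟨s, hs, hs2⟩ := (hev.and (Ioo_mem_nhdsLT hta)).exists
    rw [slope_def_field] at hs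
    have h3 : s - t₀ < 0 := sub_neg.2 hs2.2
    have h4 := hall s ⟨hs2.1.le, hs2.2.le.trans ht₀.2⟩ x₀ hx₀
    have : 0 ≤ (z s x₀ - ε * (s - a) - (z t₀ x₀ - ε * (t₀ - a))) / (s - t₀) :=
      div_nonneg_of_nonpos (by linarith) h3.le
    linarith
  by_contra hcon
  push Not at hcon
  have h0 : 0 ≤ t₁ - a := sub_nonneg.2 ht₁.1
  -- This `ε` makes the correction at time `t₁` at most half of the supposed excess over `M`; the `+
  -- 1` avoids division by zero when `t₁ = a`.
  have := main ((z t₁ x₁ - M) / (2 * (t₁ - a + 1))) (by apply div_pos <;> linarith)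
  have h5 : (z t₁ x₁ - M) / (2 * (t₁ - a + 1)) * (t₁ - a) ≤ (z t₁ x₁ - M) / 2 := by
    rw [div_mul_eq_mul_div, div_le_div_iff₀ (by linarith) (by norm_num)]
    nlinarith
  linarith

end Maximum

end CylinderFlow

/-! ### The isothermal derivative and the scalar boundary value problem for `v`. -/

namespace CylinderFlow

/-- The radius of the parallels of a rotationally symmetric metric on the cylinder. -/
structure IsProfile (ρ : ℝ) (f : ℝ → ℝ) : Prop where
  rho_pos : 0 < ρ
  smooth : ContDiffOn ℝ ∞ f (Icc (-ρ) ρ)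
  pos : ∀ σ ∈ Icc (-ρ) ρ, 0 < f σ

/-- The derivative `f ∂_σ` with respect to the isothermal coordinate. -/
noncomputable def sd (ρ : ℝ) (f : ℝ → ℝ) (u : Coord → ℝ) (x : Coord) : ℝ := f (x 1) * pd ρ 1 u x

variable {ρ T κ : ℝ} {f : ℝ → ℝ}

namespace IsProfile

variable {u w : Coord → ℝ} {x : Coord}

theorem contDiffOn (hf : IsProfile ρ f) : ContDiffOn ℝ ∞ (fun x : Coord => f (x 1)) (strip ρ) :=
  hf.smooth.comp (t := Icc (-ρ) ρ) (contDiff_apply ℝ ℝ (1 : Fin 2)).contDiffOn (fun _ hx => hx)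

theorem pos' (hf : IsProfile ρ f) (hx : x ∈ strip ρ) : 0 < f (x 1) := hf.pos _ hx

theorem contDiffOn_inv (hf : IsProfile ρ f) :
    ContDiffOn ℝ ∞ (fun x : Coord => (f (x 1))⁻¹) (strip ρ) :=
  hf.contDiffOn.inv fun _ hx => (hf.pos' hx).ne'

theorem contDiffOn_sd (hf : IsProfile ρ f) (hu : ContDiffOn ℝ ∞ u (strip ρ)) :
    ContDiffOn ℝ ∞ (sd ρ f u) (strip ρ) :=
  hf.contDiffOn.mul (contDiffOn_pd hf.rho_pos hu 1)

theorem sd_congr (h : ∀ y ∈ strip ρ, u y = w y) (hx : x ∈ strip ρ) :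
    sd ρ f u x = sd ρ f w x := by
  unfold sd; rw [pd_congr h hx]

theorem sd_add (hf : IsProfile ρ f) (hu : ContDiffOn ℝ ∞ u (strip ρ))
    (hw : ContDiffOn ℝ ∞ w (strip ρ)) (hx : x ∈ strip ρ) :
    sd ρ f (fun y => u y + w y) x = sd ρ f u x + sd ρ f w x := by
  unfold sd
  rw [pd_add hf.rho_pos hx 1 (hu.differentiableOn (by simp) x hx)
    (hw.differentiableOn (by simp) x hx)]; ring

theorem sd_sub (hf : IsProfile ρ f) (hu : ContDiffOn ℝ ∞ u (strip ρ))
    (hw : ContDiffOn ℝ ∞ w (strip ρ)) (hx : x ∈ strip ρ) :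
    sd ρ f (fun y => u y - w y) x = sd ρ f u x - sd ρ f w x := by
  unfold sd
  rw [pd_sub hf.rho_pos hx 1 (hu.differentiableOn (by simp) x hx)
    (hw.differentiableOn (by simp) x hx)]; ring

theorem sd_neg (hf : IsProfile ρ f) (hx : x ∈ strip ρ) :
    sd ρ f (fun y => - u y) x = - sd ρ f u x := by
  unfold sd
  rw [pd_neg hf.rho_pos hx 1]; ring

theorem sd_mul (hf : IsProfile ρ f) (hu : ContDiffOn ℝ ∞ u (strip ρ))
    (hw : ContDiffOn ℝ ∞ w (strip ρ)) (hx : x ∈ strip ρ) :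
    sd ρ f (fun y => u y * w y) x = sd ρ f u x * w x + u x * sd ρ f w x := by
  unfold sd
  rw [pd_mul hf.rho_pos hx 1 (hu.differentiableOn (by simp) x hx)
    (hw.differentiableOn (by simp) x hx)]; ring

theorem sd_inv (hf : IsProfile ρ f) (hu : ContDiffOn ℝ ∞ u (strip ρ)) (h0 : u x ≠ 0)
    (hx : x ∈ strip ρ) :
    sd ρ f (fun y => (u y)⁻¹) x = - sd ρ f u x / u x ^ 2 := by
  unfold sd
  rw [pd_comp hf.rho_pos hx 1 (hasDerivAt_inv h0) (hu.differentiableOn (by simp) x hx)]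
  ring

/-- At a critical point the first-order term drops out, so the sign of the second isothermal
derivative is that of the plain one. -/
theorem sd_sd (hf : IsProfile ρ f) (hu : ContDiffOn ℝ ∞ u (strip ρ)) (hx : x ∈ strip ρ) :
    sd ρ f (sd ρ f u) x = f (x 1) * (pd ρ 1 (fun y => f (y 1)) x * pd ρ 1 u x +
      f (x 1) * pd ρ 1 (pd ρ 1 u) x) := by
  conv_lhs => unfold sd
  rw [pd_mul hf.rho_pos hx 1 (hf.contDiffOn.differentiableOn (by simp) x hx)
    ((contDiffOn_pd hf.rho_pos hu 1).differentiableOn (by simp) x hx)]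

theorem sd_comp_add (u : Coord → ℝ) (a : ℝ) :
    sd ρ f (fun y => u (y + Pi.single 0 a)) = fun x => sd ρ f u (x + Pi.single 0 a) := by
  funext x
  simp [sd, pd_comp_add]

/-- Derivative test at a maximum over the strip where the outward derivative is nonpositive. -/
theorem sd_max_test (hf : IsProfile ρ f) (hu : ContDiffOn ℝ ∞ u (strip ρ)) (hx : x ∈ strip ρ)
    (hmax : IsMaxOn u (strip ρ) x) (hb : x 1 = ρ → sd ρ f u x ≤ 0)
    (hb' : x 1 = -ρ → 0 ≤ sd ρ f u x) : sd ρ f u x = 0 ∧ sd ρ f (sd ρ f u) x ≤ 0 := by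
  have hfx := hf.pos' hx
  have hρ := hf.rho_pos
  obtain ⟨-, h1, h2, h3⟩ := pd_max_test hρ hu hx hmax
  have e1 : pd ρ 1 u x ≤ 0 := by
    rcases lt_or_ge (x 1) ρ with h | h
    · exact h1 h
    · have := hb (le_antisymm hx.2 h)
      unfold sd at this
      by_contra hc
      push Not at hc
      have := mul_pos hfx hc
      linarith
  have e2 : 0 ≤ pd ρ 1 u x := by
    rcases lt_or_ge (-ρ) (x 1) with h | h
    · exact h2 h
    · have := hb' (le_antisymm h hx.1)
      unfold sd at this
      exact nonneg_of_mul_nonneg_right this hfx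
  have e : pd ρ 1 u x = 0 := le_antisymm e1 e2
  refine ⟨by simp [sd, e], ?_⟩
  rw [hf.sd_sd hu hx, e]
  have := mul_nonpos_of_nonneg_of_nonpos (mul_pos hfx hfx).le (h3 e)
  linarith

theorem jointSmooth_sd (hf : IsProfile ρ f) (hT : 0 < T) {u : ℝ → Coord → ℝ}
    (hu : JointSmooth ρ T u) : JointSmooth ρ T (fun t => sd ρ f (u t)) :=
  ContDiffOn.mul (hf.contDiffOn.comp (t := strip ρ) contDiff_snd.contDiffOn (fun _ hp => hp.2))
    (hu.pd hf.rho_pos hT 1)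

theorem hasDerivAt_sd (hf : IsProfile ρ f) {u : ℝ → Coord → ℝ}
    (hu : JointSmooth ρ T u) {t : ℝ} (ht : t ∈ Ioo 0 T) {u' : Coord → ℝ}
    (hu' : ∀ y ∈ strip ρ, HasDerivAt (fun s => u s y) (u' y) t) (hx : x ∈ strip ρ) :
    HasDerivAt (fun s => sd ρ f (u s) x) (sd ρ f u' x) t :=
  (hu.hasDerivAt_pd hf.rho_pos ht hu' hx 1).const_mul _

end IsProfile

theorem pd_periodic {u : Coord → ℝ} {a : ℝ} (hu : ∀ x ∈ strip ρ, u (x + Pi.single 0 a) = u x)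
    (i : Fin 2) : ∀ x ∈ strip ρ, pd ρ i u (x + Pi.single 0 a) = pd ρ i u x := by
  intro x hx
  rw [← pd_comp_add]
  exact pd_congr hu hx i

theorem sd_periodic {u : Coord → ℝ} {a : ℝ} (hu : ∀ x ∈ strip ρ, u (x + Pi.single 0 a) = u x) :
    ∀ x ∈ strip ρ, sd ρ f u (x + Pi.single 0 a) = sd ρ f u x := by
  intro x hx
  simp [sd, pd_periodic hu 1 x hx]

/-- The function is constant along each line in the `θ` direction, and these lines stay in the
strip. -/
theorem pd_zero_of_invariant {u : Coord → ℝ} (hd : ContDiffOn ℝ ∞ u (strip ρ))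
    (hu : ∀ a, ∀ x ∈ strip ρ, u (x + Pi.single 0 a) = u x) :
    ∀ x ∈ strip ρ, pd ρ 0 u x = 0 := by
  intro x hx
  have hmax : ∀ σ, u ![σ, x 1] = u x := fun σ => by
    rw [← hu (σ - x 0) x hx]
    congr 1
    ext i; fin_cases i <;> simp
  have h1 : HasDerivAt (fun h : ℝ => x + h • (Pi.single 0 1 : Coord)) (Pi.single 0 1) 0 := by
    simpa using ((hasDerivAt_id (0 : ℝ)).smul_const (Pi.single 0 1 : Coord)).const_add x
  have h0 : x + (0 : ℝ) • (Pi.single 0 1 : Coord) = x := by simp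
  have h2 := (hd.differentiableOn (by simp) x hx).hasFDerivWithinAt
  rw [← h0] at h2
  have h3 := h2.comp_hasDerivWithinAt (0 : ℝ) (h1.hasDerivWithinAt (s := univ))
    (fun h _ => show x + h • (Pi.single 0 1 : Coord) ∈ strip ρ by simpa [strip] using hx)
  have h4 : (u ∘ fun h : ℝ => x + h • (Pi.single 0 1 : Coord)) = fun _ => u x := by
    funext h
    rw [← hu h x hx]
    simp [← Pi.single_smul]
  rw [h4, h0] at h3
  exact ((hasDerivWithinAt_univ.1 h3).unique (hasDerivAt_const _ _))

/-- The Ricci flow with prescribed geodesic curvature of the boundary, in terms of the function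
`v` for which the metric is `v⁻² (dθ² + ds²)`, `ds = dσ / f`. -/
structure IsSol (ρ T κ : ℝ) (f : ℝ → ℝ) (v : ℝ → Coord → ℝ) : Prop where
  profile : IsProfile ρ f
  T_pos : 0 < T
  kappa_nonneg : 0 ≤ κ
  pos : ∀ t ∈ Ico 0 T, ∀ x ∈ strip ρ, 0 < v t x
  per : ∀ t ∈ Ico 0 T, ∀ x ∈ strip ρ, v t (x + Pi.single 0 (2 * Real.pi)) = v t x
  smooth : JointSmooth ρ T v
  cont : ContinuousOn (fun p : ℝ × Coord => v p.1 p.2) (Ico 0 T ×ˢ strip ρ)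
  cont_pd : ∀ i, ContinuousOn (fun p : ℝ × Coord => pd ρ i (v p.1) p.2) (Ico 0 T ×ˢ strip ρ)
  cont_pd_pd : ∀ i, ContinuousOn (fun p : ℝ × Coord => pd ρ i (pd ρ i (v p.1)) p.2)
    (Ico 0 T ×ˢ strip ρ)
  flow : ∀ t ∈ Ioo 0 T, ∀ x ∈ strip ρ, HasDerivAt (fun s => v s x)
    (v t x ^ 2 * (pd ρ 0 (pd ρ 0 (v t)) x + sd ρ f (sd ρ f (v t)) x) -
      v t x * (pd ρ 0 (v t) x ^ 2 + sd ρ f (v t) x ^ 2)) t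
  boundary : ∀ t ∈ Ioo 0 T, ∀ x ∈ strip ρ, (x 1 = ρ → sd ρ f (v t) x = κ) ∧
    (x 1 = -ρ → sd ρ f (v t) x = -κ)
  init : ∀ x ∈ strip ρ, v 0 x = (f (x 1))⁻¹

/-! ### Rotational symmetry, evolution equations and the gradient bound. -/

namespace IsSol

variable {v : ℝ → Coord → ℝ}

/-- Joint smoothness is assumed for positive times only; at `t = 0` spatial smoothness comes from
the profile. -/
theorem slice (h : IsSol ρ T κ f v) {t : ℝ} (ht : t ∈ Ico 0 T) :
    ContDiffOn ℝ ∞ (v t) (strip ρ) := by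
  rcases eq_or_lt_of_le ht.1 with h0 | h0
  · rw [← h0]
    exact h.profile.contDiffOn_inv.congr h.init
  · exact h.smooth.slice ⟨h0, ht.2⟩

theorem cont_sd (h : IsSol ρ T κ f v) :
    ContinuousOn (fun p : ℝ × Coord => sd ρ f (v p.1) p.2) (Ico 0 T ×ˢ strip ρ) :=
  ContinuousOn.mul (h.profile.contDiffOn.continuousOn.comp continuous_snd.continuousOn
    fun _ hp => hp.2) (h.cont_pd 1)

theorem cont_sd_sd (h : IsSol ρ T κ f v) :
    ContinuousOn (fun p : ℝ × Coord => sd ρ f (sd ρ f (v p.1)) p.2) (Ico 0 T ×ˢ strip ρ) := by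
  have c1 : ContinuousOn (fun p : ℝ × Coord => f (p.2 1)) (Ico 0 T ×ˢ strip ρ) :=
    h.profile.contDiffOn.continuousOn.comp continuous_snd.continuousOn fun _ hp => hp.2
  have c2 : ContinuousOn (fun p : ℝ × Coord => pd ρ 1 (fun y => f (y 1)) p.2)
      (Ico 0 T ×ˢ strip ρ) :=
    (contDiffOn_pd h.profile.rho_pos h.profile.contDiffOn 1).continuousOn.comp
      continuous_snd.continuousOn fun _ hp => hp.2
  refine (c1.mul ((c2.mul (h.cont_pd 1)).add (c1.mul (h.cont_pd_pd 1)))).congr fun p hp => ?_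
  exact h.profile.sd_sd (h.slice hp.1) hp.2

theorem exists_bound {z : ℝ → Coord → ℝ} {b : ℝ} (hb : b ∈ Ico 0 T)
    (hcont : ContinuousOn (fun p : ℝ × Coord => z p.1 p.2) (Ico 0 T ×ˢ strip ρ))
    (hper : ∀ t ∈ Ico 0 T, ∀ x ∈ strip ρ, z t (x + Pi.single 0 (2 * Real.pi)) = z t x) :
    ∃ C, 0 < C ∧ ∀ t ∈ Icc 0 b, ∀ x ∈ strip ρ, |z t x| ≤ C :=
  exists_bound_of_continuousOn
    (hcont.mono (prod_mono_left fun _ ht => ⟨ht.1, ht.2.trans_lt hb.2⟩))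
    fun t ht => hper t ⟨ht.1, ht.2.trans_lt hb.2⟩

/-- A solution is compared with its rotations. -/
theorem le_rotate (h : IsSol ρ T κ f v) (a : ℝ) {b : ℝ} (hb : b ∈ Ico 0 T) :
    ∀ x ∈ strip ρ, v b x ≤ v b (x + Pi.single 0 a) := by
  have hρ := h.profile.rho_pos
  set lap : ℝ → Coord → ℝ := fun t x => pd ρ 0 (pd ρ 0 (v t)) x + sd ρ f (sd ρ f (v t)) x
    with hlap
  have hIcc : ∀ {t}, t ∈ Icc 0 b → t ∈ Ico 0 T := fun ht => ⟨ht.1, ht.2.trans_lt hb.2⟩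
  obtain ⟨C, hC0, hC⟩ := exists_bound hb h.cont h.per
  obtain ⟨C', hC0', hC'⟩ := exists_bound (z := lap) hb ((h.cont_pd_pd 0).add h.cont_sd_sd)
    (fun t ht x hx => by
      simp only [hlap]
      rw [pd_periodic (pd_periodic (h.per t ht) 0) 0 x hx,
        sd_periodic (sd_periodic (h.per t ht)) x hx])
  -- The difference `d` of the solution and its rotation satisfies `d_t ≤ B d` at a positive spatial
  -- maximum, since `v ≤ C` and the Laplacian is at most `C'`. The weight `exp (-B t)` below absorbs
  -- this term.
  set B := 2 * C * C' with hB
  set d : ℝ → Coord → ℝ := fun t x => v t x - v t (x + Pi.single 0 a) with hd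
  have hshift : ContinuousOn (fun p : ℝ × Coord => v p.1 (p.2 + Pi.single 0 a))
      (Ico 0 T ×ˢ strip ρ) := by
    have e : Continuous (fun p : ℝ × Coord => (p.1, p.2 + (Pi.single 0 a : Coord))) := by fun_prop
    exact ContinuousOn.comp (g := fun p : ℝ × Coord => v p.1 p.2) h.cont e.continuousOn
      fun p hp => ⟨hp.1, add_single_zero_mem_strip a hp.2⟩
  have key := max_principle hρ (a := 0) (b := b) (M := 0)
    (z := fun t x => Real.exp (-(B * t)) * d t x) ?_ ?_ ?_ ?_
  · intro x hx
    have := key b ⟨hb.1, le_rfl⟩ x hx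
    have h2 := nonpos_of_mul_nonpos_right this (Real.exp_pos _)
    simp only [hd] at h2
    linarith
  · refine ContinuousOn.mono ?_ (prod_mono_left (s₂ := Ico 0 T) fun _ ht => hIcc ht)
    exact ContinuousOn.mul (by fun_prop) (h.cont.sub hshift)
  · intro t ht x hx
    have e : v t (x + Pi.single 0 (2 * Real.pi) + Pi.single 0 a) = v t (x + Pi.single 0 a) := by
      rw [add_right_comm, h.per t (hIcc ht) _ (add_single_zero_mem_strip a hx)]
    simp only [hd, h.per t (hIcc ht) x hx, e]
  · intro x hx
    have hx' := add_single_zero_mem_strip a hx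
    simp [hd, h.init x hx, h.init _ hx']
  · intro t ht x hx hmax hpos
    have ht' : t ∈ Ioo 0 T := ⟨ht.1, ht.2.trans_lt hb.2⟩
    have ht'' : t ∈ Ico 0 T := ⟨ht'.1.le, ht'.2⟩
    have htI : t ∈ Icc 0 b := ⟨ht.1.le, ht.2⟩
    have hx' := add_single_zero_mem_strip a hx
    have hE := Real.exp_pos (-(B * t))
    have hdpos : 0 < d t x := pos_of_mul_pos_right (by simpa using hpos) hE.le
    have hmax' : IsMaxOn (d t) (strip ρ) x := fun y hy =>
      le_of_mul_le_mul_left (hmax hy) hE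
    have hs1 : ContDiffOn ℝ ∞ (v t) (strip ρ) := h.slice ht''
    have hs2 : ContDiffOn ℝ ∞ (fun y => v t (y + Pi.single 0 a)) (strip ρ) :=
      hs1.comp (t := strip ρ) (by fun_prop) fun y hy => add_single_zero_mem_strip a hy
    have hsd : ContDiffOn ℝ ∞ (d t) (strip ρ) := hs1.sub hs2
    have D1 : ∀ y ∈ strip ρ, sd ρ f (d t) y = sd ρ f (v t) y -
        sd ρ f (v t) (y + Pi.single 0 a) := by
      intro y hy
      have := h.profile.sd_sub hs1 hs2 hy
      rw [IsProfile.sd_comp_add] at this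
      exact this
    have D2 : sd ρ f (sd ρ f (d t)) x = sd ρ f (sd ρ f (v t)) x -
        sd ρ f (sd ρ f (v t)) (x + Pi.single 0 a) := by
      rw [IsProfile.sd_congr D1 hx, h.profile.sd_sub (h.profile.contDiffOn_sd hs1) (by
        rw [← IsProfile.sd_comp_add]; exact h.profile.contDiffOn_sd hs2) hx,
        IsProfile.sd_comp_add]
    have P1 : ∀ y ∈ strip ρ, pd ρ 0 (d t) y = pd ρ 0 (v t) y -
        pd ρ 0 (v t) (y + Pi.single 0 a) := by
      intro y hy
      have := pd_sub hρ hy 0 (hs1.differentiableOn (by simp) y hy)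
        (hs2.differentiableOn (by simp) y hy)
      rw [pd_comp_add] at this
      exact this
    have P2 : pd ρ 0 (pd ρ 0 (d t)) x = pd ρ 0 (pd ρ 0 (v t)) x -
        pd ρ 0 (pd ρ 0 (v t)) (x + Pi.single 0 a) := by
      have e : (fun y => pd ρ 0 (v t) (y + Pi.single 0 a)) =
        pd ρ 0 (fun y => v t (y + Pi.single 0 a)) := by
        funext y; rw [pd_comp_add]
      rw [pd_congr P1 hx, pd_sub hρ hx 0
        ((contDiffOn_pd hρ hs1 0).differentiableOn (by simp) x hx) (by
          rw [e]; exact (contDiffOn_pd hρ hs2 0).differentiableOn (by simp) x hx),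
        pd_comp_add]
    have hb0 := h.boundary t ht' x hx
    have hb1 := h.boundary t ht' _ hx'
    have e1 : (x + (Pi.single 0 a : Coord)) 1 = x 1 := by simp
    rw [e1] at hb1
    -- Both functions have the same Neumann data, so the normal derivative of `d` vanishes and the
    -- test applies at the boundary.
    obtain ⟨t1, t2⟩ := h.profile.sd_max_test hsd hx hmax'
      (fun e => by rw [D1 x hx, hb0.1 e, hb1.1 e]; simp)
      (fun e => by rw [D1 x hx, hb0.2 e, hb1.2 e]; simp)
    obtain ⟨⟨t3, t4⟩, -⟩ := pd_max_test hρ hsd hx hmax'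
    rw [D1 x hx] at t1
    rw [P1 x hx] at t3
    rw [D2] at t2
    rw [P2] at t4
    have f1 := h.flow t ht' x hx
    have f2 := h.flow t ht' _ hx'
    have f3 : HasDerivAt (fun s => Real.exp (-(B * s))) (Real.exp (-(B * t)) * (-(B * 1))) t :=
      (((hasDerivAt_id t).const_mul B).neg).exp
    refine ⟨_, ?_, f3.mul (f1.sub f2)⟩
    have v1 := h.pos t ht'' x hx
    have v2 := h.pos t ht'' _ hx'
    have b1 := (abs_le.1 (hC t htI x hx)).2
    have b2 := (abs_le.1 (hC t htI _ hx')).2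
    have b3 := (abs_le.1 (hC' t htI _ hx')).2
    simp only [hlap] at b3
    simp only [hd] at hdpos
    rw [← sub_eq_zero.1 t1, ← sub_eq_zero.1 t3]
    set V := v t x
    set W := v t (x + Pi.single 0 a)
    set L1 := pd ρ 0 (pd ρ 0 (v t)) x + sd ρ f (sd ρ f (v t)) x
    set L2 := pd ρ 0 (pd ρ 0 (v t)) (x + Pi.single 0 a) +
      sd ρ f (sd ρ f (v t)) (x + Pi.single 0 a)
    set G := pd ρ 0 (v t) x ^ 2 + sd ρ f (v t) x ^ 2
    have hG : 0 ≤ G := by positivity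
    have hL : L1 ≤ L2 := by simp only [L1, L2]; linarith
    have i1 : V ^ 2 * L1 ≤ V ^ 2 * L2 := mul_le_mul_of_nonneg_left hL (sq_nonneg _)
    have i2 : (V + W) * L2 ≤ B := by
      calc (V + W) * L2 ≤ (V + W) * C' := mul_le_mul_of_nonneg_left b3 (by linarith)
        _ ≤ (C + C) * C' := mul_le_mul_of_nonneg_right (by linarith) hC0'.le
        _ = B := by rw [hB]; ring
    have i3 := mul_le_mul_of_nonneg_left i2 hdpos.le
    have i4 := mul_nonneg hdpos.le hG
    -- At the maximum the gradients agree and `L1 ≤ L2`, so the difference of the two equations is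
    -- at most `(V - W) ((V + W) L2 - G)`.
    have i5 : V ^ 2 * L1 - V * G - (W ^ 2 * L2 - W * G) - B * (V - W) ≤ 0 := by nlinarith
    have i6 := mul_nonpos_of_nonneg_of_nonpos hE.le i5
    simp only [hd]
    linarith

/-- Comparison with the rotation by `a` gives one inequality, and the rotation by `-a` from the
shifted point gives the other. -/
theorem rotate_eq (h : IsSol ρ T κ f v) (a : ℝ) {t : ℝ} (ht : t ∈ Ico 0 T) {x : Coord}
    (hx : x ∈ strip ρ) : v t (x + Pi.single 0 a) = v t x := by
  refine le_antisymm ?_ (h.le_rotate a ht x hx)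
  have := h.le_rotate (-a) ht _ (add_single_zero_mem_strip a hx)
  simpa [add_assoc, ← Pi.single_add] using this

theorem pd_zero (h : IsSol ρ T κ f v) {t : ℝ} (ht : t ∈ Ico 0 T) {x : Coord}
    (hx : x ∈ strip ρ) : pd ρ 0 (v t) x = 0 :=
  pd_zero_of_invariant (h.slice ht) (fun a _ hy => h.rotate_eq a ht hy) x hx

theorem pd_zero_pd_zero (h : IsSol ρ T κ f v) {t : ℝ} (ht : t ∈ Ico 0 T) {x : Coord}
    (hx : x ∈ strip ρ) : pd ρ 0 (pd ρ 0 (v t)) x = 0 := by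
  rw [pd_congr (w := fun _ => 0) (fun y hy => h.pd_zero ht hy) hx, pd_const]

theorem hasDerivAt (h : IsSol ρ T κ f v) {t : ℝ} (ht : t ∈ Ioo 0 T) {x : Coord}
    (hx : x ∈ strip ρ) : HasDerivAt (fun s => v s x)
      (v t x ^ 2 * sd ρ f (sd ρ f (v t)) x - v t x * sd ρ f (v t) x ^ 2) t := by
  have := h.flow t ht x hx
  rw [h.pd_zero ⟨ht.1.le, ht.2⟩ hx, h.pd_zero_pd_zero ⟨ht.1.le, ht.2⟩ hx] at this
  simpa using this

/-- On differentiating the equation the terms `2 v v_s v_ss` cancel. With `p = v_s` this leaves `p_t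
= v² p_ss - p³`, whose reaction term is damping. -/
theorem hasDerivAt_sd (h : IsSol ρ T κ f v) {t : ℝ} (ht : t ∈ Ioo 0 T) {x : Coord}
    (hx : x ∈ strip ρ) : HasDerivAt (fun s => sd ρ f (v s) x)
      (v t x ^ 2 * sd ρ f (sd ρ f (sd ρ f (v t))) x - sd ρ f (v t) x ^ 3) t := by
  have hf := h.profile
  have s0 := h.slice ⟨ht.1.le, ht.2⟩
  have s1 := hf.contDiffOn_sd s0
  have s2 := hf.contDiffOn_sd s1
  have h1 := hf.hasDerivAt_sd h.smooth ht (u' := fun y => v t y * v t y * sd ρ f (sd ρ f (v t)) y -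
    v t y * (sd ρ f (v t) y * sd ρ f (v t) y))
    (fun y hy => by convert h.hasDerivAt ht hy using 1; ring) hx
  rw [hf.sd_sub ((s0.mul s0).mul s2) (s0.mul (s1.mul s1)) hx, hf.sd_mul (s0.mul s0) s2 hx,
    hf.sd_mul s0 s0 hx, hf.sd_mul s0 (s1.mul s1) hx, hf.sd_mul s1 s1 hx] at h1
  convert h1 using 1
  ring

/-- With `w = v_ss` this is `w_t = v² w_ss + 2 v v_s w_s - 3 v_s² w`; the zeroth-order term again
has the favourable sign. -/
theorem hasDerivAt_sd_sd (h : IsSol ρ T κ f v) {t : ℝ} (ht : t ∈ Ioo 0 T) {x : Coord}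
    (hx : x ∈ strip ρ) : HasDerivAt (fun s => sd ρ f (sd ρ f (v s)) x)
      (v t x ^ 2 * sd ρ f (sd ρ f (sd ρ f (sd ρ f (v t)))) x +
        2 * v t x * sd ρ f (v t) x * sd ρ f (sd ρ f (sd ρ f (v t))) x -
        3 * sd ρ f (v t) x ^ 2 * sd ρ f (sd ρ f (v t)) x) t := by
  have hf := h.profile
  have s0 := h.slice ⟨ht.1.le, ht.2⟩
  have s1 := hf.contDiffOn_sd s0
  have s2 := hf.contDiffOn_sd s1
  have s3 := hf.contDiffOn_sd s2
  have h1 := hf.hasDerivAt_sd (hf.jointSmooth_sd h.T_pos h.smooth) ht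
    (u' := fun y => v t y * v t y * sd ρ f (sd ρ f (sd ρ f (v t))) y -
      sd ρ f (v t) y * (sd ρ f (v t) y * sd ρ f (v t) y))
    (fun y hy => by convert h.hasDerivAt_sd ht hy using 1; ring) hx
  rw [hf.sd_sub ((s0.mul s0).mul s3) (s1.mul (s1.mul s1)) hx, hf.sd_mul (s0.mul s0) s3 hx,
    hf.sd_mul s0 s0 hx, hf.sd_mul s1 (s1.mul s1) hx, hf.sd_mul s1 s1 hx] at h1
  convert h1 using 1
  ring

/-- The third derivative at the boundary. -/
theorem boundary_sd_sd_sd (h : IsSol ρ T κ f v) {t : ℝ} (ht : t ∈ Ioo 0 T) {x : Coord}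
    (hx : x ∈ strip ρ) (hb : x 1 = ρ ∨ x 1 = -ρ) :
    v t x ^ 2 * sd ρ f (sd ρ f (sd ρ f (v t))) x = sd ρ f (v t) x ^ 3 := by
  have h1 := h.hasDerivAt_sd ht hx
  -- The Neumann data are constant in time, so the evolution equation of `v_s` turns into a relation
  -- between space derivatives on the boundary.
  have h2 : HasDerivAt (fun s => sd ρ f (v s) x) 0 t := by
    refine (hasDerivAt_const t (sd ρ f (v t) x)).congr_of_eventuallyEq ?_
    filter_upwards [Ioo_mem_nhds ht.1 ht.2] with s hs
    rcases hb with hb | hb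
    · rw [(h.boundary s hs x hx).1 hb, (h.boundary t ht x hx).1 hb]
    · rw [(h.boundary s hs x hx).2 hb, (h.boundary t ht x hx).2 hb]
  have := h1.unique h2
  linarith

/-- The outward derivative of `-v` is `-κ ≤ 0`, so the boundary cannot spoil the test; at a minimum
`v_s = 0` and `v_t = v² v_ss ≥ 0`. It makes the minimum of `v` nondecreasing. -/
theorem mono_min (h : IsSol ρ T κ f v) {a b m : ℝ} (ha : 0 ≤ a) (hab : a ≤ b) (hb : b < T)
    (hm : ∀ x ∈ strip ρ, m ≤ v a x) : ∀ x ∈ strip ρ, m ≤ v b x := by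
  have hIcc : ∀ {t}, t ∈ Icc a b → t ∈ Ico 0 T :=
    fun ht => ⟨ha.trans ht.1, ht.2.trans_lt hb⟩
  have key := max_principle h.profile.rho_pos (a := a) (b := b) (M := -m)
    (z := fun t x => -(v t x)) (h.cont.neg.mono (prod_mono_left fun _ ht => hIcc ht))
    (fun t ht x hx => by rw [h.per t (hIcc ht) x hx]) (fun x hx => by linarith [hm x hx]) ?_
  · intro x hx
    linarith [key b ⟨hab, le_rfl⟩ x hx]
  · intro t ht x hx hmax _
    have ht' : t ∈ Ioo 0 T := ⟨ha.trans_lt ht.1, ht.2.trans_lt hb⟩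
    have s0 := h.slice ⟨ht'.1.le, ht'.2⟩
    have D1 : ∀ y ∈ strip ρ, sd ρ f (fun x => -(v t x)) y = -sd ρ f (v t) y :=
      fun y hy => h.profile.sd_neg hy
    have D2 : sd ρ f (sd ρ f (fun x => -(v t x))) x = -sd ρ f (sd ρ f (v t)) x := by
      rw [IsProfile.sd_congr D1 hx, h.profile.sd_neg hx]
    have hb0 := h.boundary t ht' x hx
    obtain ⟨t1, t2⟩ := h.profile.sd_max_test s0.neg hx hmax
      (fun e => by rw [D1 x hx, hb0.1 e]; linarith [h.kappa_nonneg])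
      (fun e => by rw [D1 x hx, hb0.2 e]; linarith [h.kappa_nonneg])
    rw [D1 x hx] at t1
    rw [D2] at t2
    refine ⟨_, ?_, (h.hasDerivAt ht' hx).neg⟩
    rw [neg_eq_zero.1 t1]
    nlinarith [sq_nonneg (v t x)]

/-- Gradient bound. -/
theorem abs_sd_le (h : IsSol ρ T κ f v) {C : ℝ} (hκ : κ ≤ C)
    (h0 : ∀ x ∈ strip ρ, |sd ρ f (v 0) x| ≤ C) {t : ℝ} (ht : t ∈ Ico 0 T) :
    ∀ x ∈ strip ρ, |sd ρ f (v t) x| ≤ C := by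
  have hIcc : ∀ {s}, s ∈ Icc 0 t → s ∈ Ico 0 T := fun hs => ⟨hs.1, hs.2.trans_lt ht.2⟩
  have hC : 0 ≤ C := h.kappa_nonneg.trans hκ
  have hf := h.profile
  -- On the boundary `|v_s| = κ ≤ C`, so a maximum above `C` is interior, and there the cubic term
  -- pushes it down.
  have key1 := max_principle hf.rho_pos (a := 0) (b := t) (M := C)
    (z := fun t x => sd ρ f (v t) x) (h.cont_sd.mono (prod_mono_left fun _ hs => hIcc hs))
    (fun s hs x hx => sd_periodic (h.per s (hIcc hs)) x hx)
    (fun x hx => (abs_le.1 (h0 x hx)).2) ?_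
  have key2 := max_principle hf.rho_pos (a := 0) (b := t) (M := C)
    (z := fun t x => -sd ρ f (v t) x) (h.cont_sd.neg.mono (prod_mono_left fun _ hs => hIcc hs))
    (fun s hs x hx => by rw [sd_periodic (h.per s (hIcc hs)) x hx])
    (fun x hx => by linarith [(abs_le.1 (h0 x hx)).1]) ?_
  · intro x hx
    rw [abs_le]
    have i1 := key1 t ⟨ht.1, le_rfl⟩ x hx
    have i2 := key2 t ⟨ht.1, le_rfl⟩ x hx
    exact ⟨by linarith, i1⟩
  · intro s hs x hx hmax hgt
    have hs' : s ∈ Ioo 0 T := ⟨hs.1, hs.2.trans_lt ht.2⟩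
    have s0 := h.slice ⟨hs'.1.le, hs'.2⟩
    have hb0 := h.boundary s hs' x hx
    have D1 : ∀ y ∈ strip ρ, sd ρ f (fun x => -(sd ρ f (v s) x)) y = -sd ρ f (sd ρ f (v s)) y :=
      fun y hy => hf.sd_neg hy
    have D2 : sd ρ f (sd ρ f (fun x => -(sd ρ f (v s) x))) x =
        -sd ρ f (sd ρ f (sd ρ f (v s))) x := by
      rw [IsProfile.sd_congr D1 hx, hf.sd_neg hx]
    obtain ⟨t1, t2⟩ := hf.sd_max_test (hf.contDiffOn_sd s0).neg hx hmax
      (fun e => by have := hb0.1 e; have := h.kappa_nonneg; linarith)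
      (fun e => by have := hb0.2 e; have := h.kappa_nonneg; linarith)
    rw [D2] at t2
    refine ⟨_, ?_, (h.hasDerivAt_sd hs' hx).neg⟩
    have i1 : 0 ≤ -sd ρ f (v s) x := by linarith
    have i2 : 0 ≤ (-sd ρ f (v s) x) ^ 3 := pow_nonneg i1 3
    have i3 := mul_nonneg (sq_nonneg (v s x)) (neg_nonpos.1 t2)
    nlinarith
  · intro s hs x hx hmax hgt
    have hs' : s ∈ Ioo 0 T := ⟨hs.1, hs.2.trans_lt ht.2⟩
    have s0 := h.slice ⟨hs'.1.le, hs'.2⟩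
    have hb0 := h.boundary s hs' x hx
    obtain ⟨t1, t2⟩ := hf.sd_max_test (hf.contDiffOn_sd s0) hx hmax
      (fun e => by have := hb0.1 e; have := h.kappa_nonneg; linarith)
      (fun e => by have := hb0.2 e; have := h.kappa_nonneg; linarith)
    refine ⟨_, ?_, h.hasDerivAt_sd hs' hx⟩
    have i1 : 0 ≤ sd ρ f (v s) x := by linarith
    have i2 : 0 ≤ sd ρ f (v s) x ^ 3 := pow_nonneg i1 3
    have i3 := mul_nonpos_of_nonneg_of_nonpos (sq_nonneg (v s x)) t2
    linarith

end IsSol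

end CylinderFlow

/-! ### Second derivative bound, oscillation bound and linear growth. -/

namespace CylinderFlow

variable {ρ T κ : ℝ} {f : ℝ → ℝ}

namespace IsSol

variable {v : ℝ → Coord → ℝ}

/-- Bound on the second derivative. -/
theorem abs_sd_sd_le (h : IsSol ρ T κ f v) {W m : ℝ} (hm : 0 < m) (hm0 : ∀ x ∈ strip ρ, m ≤ v 0 x)
    (h0 : ∀ x ∈ strip ρ, |sd ρ f (sd ρ f (v 0)) x| ≤ W) {t : ℝ} (ht : t ∈ Ico 0 T) :
    ∀ x ∈ strip ρ, |sd ρ f (sd ρ f (v t)) x| ≤ W + 2 * κ ^ 2 / m := by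
  have hIcc : ∀ {s}, s ∈ Icc 0 t → s ∈ Ico 0 T := fun hs => ⟨hs.1, hs.2.trans_lt ht.2⟩
  have hf := h.profile
  have hκ := h.kappa_nonneg
  have hW : ∀ x ∈ strip ρ, 0 ≤ W := fun x hx => (abs_nonneg _).trans (h0 x hx)
  have hvm : ∀ s ∈ Icc 0 t, ∀ x ∈ strip ρ, m ≤ v s x :=
    fun s hs => h.mono_min le_rfl hs.1 (hs.2.trans_lt ht.2) hm0
  have hinv : ∀ s ∈ Icc 0 t, ∀ x ∈ strip ρ, (v s x)⁻¹ ≤ m⁻¹ :=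
    fun s hs x hx => inv_anti₀ hm (hvm s hs x hx)
  have hminv : 0 < m⁻¹ := inv_pos.2 hm
  have key1 := max_principle hf.rho_pos (a := 0) (b := t) (M := W + 2 * κ ^ 2 / m)
    (z := fun t x => -sd ρ f (sd ρ f (v t)) x)
    (h.cont_sd_sd.neg.mono (prod_mono_left fun _ hs => hIcc hs))
    (fun s hs x hx => by rw [sd_periodic (sd_periodic (h.per s (hIcc hs))) x hx])
    (fun x hx => by
      have : 0 ≤ 2 * κ ^ 2 / m := by positivity
      linarith [(abs_le.1 (h0 x hx)).1]) ?_
  -- For the upper bound the boundary flux `v_sss = v_s³ / v²` has the wrong sign. Since `v_s² = κ²`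
  -- there, adding `κ² / v` cancels the flux exactly.
  have key2 := max_principle hf.rho_pos (a := 0) (b := t) (M := W + 2 * κ ^ 2 / m)
    (z := fun t x => sd ρ f (sd ρ f (v t)) x + κ ^ 2 * (v t x)⁻¹) ?_
    (fun s hs x hx => by
      rw [sd_periodic (sd_periodic (h.per s (hIcc hs))) x hx, h.per s (hIcc hs) x hx])
    (fun x hx => by
      have h1 := (abs_le.1 (h0 x hx)).2
      have h2 := mul_le_mul_of_nonneg_left (hinv 0 ⟨le_rfl, ht.1⟩ x hx) (sq_nonneg κ)
      have h3 : 0 ≤ κ ^ 2 * m⁻¹ := by positivity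
      rw [div_eq_mul_inv]
      linarith) ?_
  · intro x hx
    rw [abs_le]
    have i1 := key1 t ⟨ht.1, le_rfl⟩ x hx
    have i2 := key2 t ⟨ht.1, le_rfl⟩ x hx
    have i3 : 0 ≤ κ ^ 2 * (v t x)⁻¹ :=
      mul_nonneg (sq_nonneg _) (inv_nonneg.2 (h.pos t ht x hx).le)
    exact ⟨by linarith, by linarith⟩
  · exact (h.cont_sd_sd.add (continuousOn_const.mul (h.cont.inv₀
      fun p hp => (h.pos p.1 hp.1 p.2 hp.2).ne'))).mono (prod_mono_left fun _ hs => hIcc hs)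
  · intro s hs x hx hmax hgt
    have hs' : s ∈ Ioo 0 T := ⟨hs.1, hs.2.trans_lt ht.2⟩
    have hs'' : s ∈ Ico 0 T := ⟨hs'.1.le, hs'.2⟩
    have hsI : s ∈ Icc 0 t := ⟨hs.1.le, hs.2⟩
    have s0 := h.slice hs''
    have s1 := hf.contDiffOn_sd s0
    have s2 := hf.contDiffOn_sd s1
    have s3 := hf.contDiffOn_sd s2
    have hvp : ∀ y ∈ strip ρ, v s y ≠ 0 := fun y hy => (h.pos s hs'' y hy).ne'
    have si : ContDiffOn ℝ ∞ (fun y => (v s y)⁻¹) (strip ρ) := s0.inv hvp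
    have cc : ContDiffOn ℝ ∞ (fun _ : Coord => κ ^ 2) (strip ρ) := contDiffOn_const
    have hsc : ∀ y, sd ρ f (fun _ => κ ^ 2) y = 0 := fun y => by simp [sd, pd_const]
    have D1 : ∀ y ∈ strip ρ, sd ρ f (fun x => sd ρ f (sd ρ f (v s)) x + κ ^ 2 * (v s x)⁻¹) y =
        sd ρ f (sd ρ f (sd ρ f (v s))) y -
          κ ^ 2 * (sd ρ f (v s) y * ((v s y)⁻¹ * (v s y)⁻¹)) := by
      intro y hy
      rw [hf.sd_add s2 (cc.mul si) hy, hf.sd_mul cc si hy, hsc, hf.sd_inv s0 (hvp y hy) hy]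
      have := hvp y hy
      field_simp
      ring
    have D2 : sd ρ f (sd ρ f (fun x => sd ρ f (sd ρ f (v s)) x + κ ^ 2 * (v s x)⁻¹)) x =
        sd ρ f (sd ρ f (sd ρ f (sd ρ f (v s)))) x - κ ^ 2 *
          (sd ρ f (sd ρ f (v s)) x / v s x ^ 2 - 2 * sd ρ f (v s) x ^ 2 / v s x ^ 3) := by
      rw [IsProfile.sd_congr D1 hx, hf.sd_sub s3 (cc.mul (s1.mul (si.mul si))) hx,
        hf.sd_mul cc (s1.mul (si.mul si)) hx, hsc, hf.sd_mul s1 (si.mul si) hx,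
        hf.sd_mul si si hx, hf.sd_inv s0 (hvp x hx) hx]
      have := hvp x hx
      field_simp
      ring
    have hb0 := h.boundary s hs' x hx
    have hV := h.pos s hs'' x hx
    have hzero : ∀ e : x 1 = ρ ∨ x 1 = -ρ, sd ρ f (sd ρ f (sd ρ f (v s))) x -
          κ ^ 2 * (sd ρ f (v s) x * ((v s x)⁻¹ * (v s x)⁻¹)) = 0 := by
      intro e
      have h3 := h.boundary_sd_sd_sd hs' hx e
      have hp : sd ρ f (v s) x ^ 2 = κ ^ 2 := by
        rcases e with e | e
        · rw [hb0.1 e]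
        · rw [hb0.2 e]; ring
      have : sd ρ f (sd ρ f (sd ρ f (v s))) x = sd ρ f (v s) x ^ 3 / v s x ^ 2 := by
        rw [eq_div_iff (by positivity)]; linarith
      rw [this, ← hp]
      field_simp
      ring
    obtain ⟨t1, t2⟩ := hf.sd_max_test (s2.add (cc.mul si)) hx hmax
      (fun e => by rw [D1 x hx, hzero (Or.inl e)])
      (fun e => by rw [D1 x hx, hzero (Or.inr e)])
    rw [D1 x hx] at t1
    rw [D2] at t2
    have hd := (h.hasDerivAt_sd_sd hs' hx).add
      (((h.hasDerivAt hs' hx).inv (hvp x hx)).const_mul (κ ^ 2))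
    refine ⟨_, ?_, hd⟩
    have hi := hinv s hsI x hx
    -- This is what the factor `2` in `2 κ² / m` buys: above the threshold `w` exceeds `κ² / m ≥ κ²
    -- / v`. The time derivative at the maximum is at most `p² (κ² / v - 3 w)`.
    have hgt' : κ ^ 2 * (v s x)⁻¹ ≤ 3 * sd ρ f (sd ρ f (v s)) x := by
      have h2 := mul_le_mul_of_nonneg_left hi (sq_nonneg κ)
      have h3 : 0 ≤ κ ^ 2 * m⁻¹ := by positivity
      rw [div_eq_mul_inv] at hgt
      have := hW x hx
      linarith
    set V := v s x
    set p := sd ρ f (v s) x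
    set w := sd ρ f (sd ρ f (v s)) x
    set q := sd ρ f (sd ρ f (sd ρ f (v s))) x
    set r := sd ρ f (sd ρ f (sd ρ f (sd ρ f (v s)))) x
    have hq : q = κ ^ 2 * (p * (V⁻¹ * V⁻¹)) := sub_eq_zero.1 t1
    have hr : V ^ 2 * r ≤ V ^ 2 * (κ ^ 2 * (w / V ^ 2 - 2 * p ^ 2 / V ^ 3)) :=
      mul_le_mul_of_nonneg_left (by linarith) (sq_nonneg V)
    have e1 : V ^ 2 * (κ ^ 2 * (w / V ^ 2 - 2 * p ^ 2 / V ^ 3)) =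
        κ ^ 2 * w - 2 * κ ^ 2 * p ^ 2 * V⁻¹ := by field_simp
    have e2 : 2 * V * p * q = 2 * κ ^ 2 * p ^ 2 * V⁻¹ := by
      rw [hq]; field_simp
    have e3 : κ ^ 2 * (-(V ^ 2 * w - V * p ^ 2) / V ^ 2) = - κ ^ 2 * w + κ ^ 2 * p ^ 2 * V⁻¹ := by
      field_simp
      ring
    have e4 := mul_nonneg (sq_nonneg p) (sub_nonneg.2 hgt')
    nlinarith
  · intro s hs x hx hmax hgt
    have hs' : s ∈ Ioo 0 T := ⟨hs.1, hs.2.trans_lt ht.2⟩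
    have hs'' : s ∈ Ico 0 T := ⟨hs'.1.le, hs'.2⟩
    have s0 := h.slice hs''
    have s1 := hf.contDiffOn_sd s0
    have s2 := hf.contDiffOn_sd s1
    have hV := h.pos s hs'' x hx
    have hb0 := h.boundary s hs' x hx
    have D1 : ∀ y ∈ strip ρ, sd ρ f (fun x => -(sd ρ f (sd ρ f (v s)) x)) y =
        -sd ρ f (sd ρ f (sd ρ f (v s))) y := fun y hy => hf.sd_neg hy
    have D2 : sd ρ f (sd ρ f (fun x => -(sd ρ f (sd ρ f (v s)) x))) x =
        -sd ρ f (sd ρ f (sd ρ f (sd ρ f (v s)))) x := by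
      rw [IsProfile.sd_congr D1 hx, hf.sd_neg hx]
    have hq : ∀ e : x 1 = ρ ∨ x 1 = -ρ, sd ρ f (sd ρ f (sd ρ f (v s))) x =
        sd ρ f (v s) x ^ 3 / v s x ^ 2 := by
      intro e
      have h3 := h.boundary_sd_sd_sd hs' hx e
      rw [eq_div_iff (by positivity)]; linarith
    -- For the lower bound the flux helps: the outward derivative of `-w` is `-κ³ / v² ≤ 0`, so no
    -- correction is needed.
    obtain ⟨t1, t2⟩ := hf.sd_max_test s2.neg hx hmax
      (fun e => by
        rw [D1 x hx, hq (Or.inl e), hb0.1 e]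
        exact neg_nonpos.2 (by positivity))
      (fun e => by
        rw [D1 x hx, hq (Or.inr e), hb0.2 e]
        have : (-κ) ^ 3 / v s x ^ 2 = -(κ ^ 3 / v s x ^ 2) := by ring
        rw [this, neg_neg]
        positivity)
    rw [D1 x hx] at t1
    rw [D2] at t2
    refine ⟨_, ?_, (h.hasDerivAt_sd_sd hs' hx).neg⟩
    rw [neg_eq_zero.1 t1]
    have hneg : sd ρ f (sd ρ f (v s)) x ≤ 0 := by
      have := hW x hx
      have : 0 ≤ 2 * κ ^ 2 / m := by positivity
      linarith
    have i1 := mul_nonneg (sq_nonneg (v s x)) (neg_nonpos.1 t2)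
    have i2 := mul_nonpos_of_nonneg_of_nonpos (sq_nonneg (sd ρ f (v s) x)) hneg
    linarith

/-- Harnack estimate. -/
theorem sub_le (h : IsSol ρ T κ f v) {C a : ℝ} (ha : 0 < a) (hfa : ∀ σ ∈ Icc (-ρ) ρ, a ≤ f σ)
    {t : ℝ} (ht : t ∈ Ico 0 T) (hC : ∀ x ∈ strip ρ, |sd ρ f (v t) x| ≤ C) :
    ∀ x ∈ strip ρ, ∀ y ∈ strip ρ, v t x - v t y ≤ C / a * (2 * ρ) := by
  intro x hx y hy
  -- By symmetry two points can be moved to one meridian, of coordinate length at most `2 ρ`, along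
  -- which the gradient bound is integrated.
  have hrot : ∀ z ∈ strip ρ, v t z = v t ![0, z 1] := by
    intro z hz
    rw [← h.rotate_eq (-(z 0)) ht hz]
    congr 1
    ext i; fin_cases i <;> simp
  have hd : ∀ σ ∈ Icc (-ρ) ρ, HasDerivWithinAt (fun σ : ℝ => v t (![0, σ] : Coord))
      (pd ρ 1 (v t) ![0, σ]) (Icc (-ρ) ρ) σ := by
    intro σ hσ
    have h1 : HasDerivAt (fun σ : ℝ => (![0, σ] : Coord)) (Pi.single 1 1) σ := by
      rw [hasDerivAt_pi]
      intro i; fin_cases i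
      · simpa using hasDerivAt_const σ (0 : ℝ)
      · simpa using hasDerivAt_id' σ
    exact ((h.slice ht).differentiableOn (by simp) _ hσ).hasFDerivWithinAt.comp_hasDerivWithinAt σ
      h1.hasDerivWithinAt (fun s hs => hs)
  have hb : ∀ σ ∈ Icc (-ρ) ρ, ‖pd ρ 1 (v t) ![0, σ]‖ ≤ C / a := by
    intro σ hσ
    have h1 := hC ![0, σ] hσ
    have h2 := hfa σ hσ
    simp only [sd, abs_mul] at h1
    rw [Real.norm_eq_abs, le_div_iff₀ ha, mul_comm]
    refine le_trans (mul_le_mul_of_nonneg_right ?_ (abs_nonneg _)) h1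
    exact h2.trans (le_abs_self _)
  have hmv := (convex_Icc (-ρ) ρ).norm_image_sub_le_of_norm_hasDerivWithin_le hd hb hy hx
  rw [hrot x hx, hrot y hy]
  have hCa : 0 ≤ C / a := (norm_nonneg _).trans (hb (y 1) hy)
  refine (le_abs_self _).trans (hmv.trans (mul_le_mul_of_nonneg_left ?_ hCa))
  rw [Real.norm_eq_abs, abs_le]
  have := hx.1
  have := hx.2
  have := hy.1
  have := hy.2
  constructor <;> linarith

end IsSol

/-- A function with unit isothermal derivative. -/
theorem IsProfile.exists_isothermal (hf : IsProfile ρ f) :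
    ∃ (S : Coord → ℝ) (B : ℝ), 0 < B ∧ ContDiffOn ℝ ∞ S (strip ρ) ∧
      (∀ x ∈ strip ρ, sd ρ f S x = 1) ∧
      (∀ x ∈ strip ρ, |S x| ≤ B) ∧ ∀ x ∈ strip ρ, S (x + Pi.single 0 (2 * Real.pi)) = S x := by
  have hρ : -ρ < ρ := by linarith [hf.rho_pos]
  have hinv : ContDiffOn ℝ ∞ (fun σ => (f σ)⁻¹) (Icc (-ρ) ρ) :=
    hf.smooth.inv fun σ hσ => (hf.pos σ hσ).ne'
  -- The continuous extension of `1 / f` to the line makes its primitive differentiable at the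
  -- endpoints as well.
  set F : ℝ → ℝ := IccExtend hρ.le ((Icc (-ρ) ρ).domRestrict fun σ => (f σ)⁻¹) with hF
  have hFc : Continuous F := (continuousOn_iff_continuous_domRestrict.1 hinv.continuousOn).Icc_extend'
  have hFe : ∀ σ ∈ Icc (-ρ) ρ, F σ = (f σ)⁻¹ := fun σ hσ => by
    rw [hF, IccExtend_of_mem _ _ hσ]; rfl
  set G : ℝ → ℝ := fun σ => ∫ s in (0 : ℝ)..σ, F s with hG
  have hGd : ∀ σ, HasDerivAt G (F σ) σ := fun σ =>
    intervalIntegral.integral_hasDerivAt_right (hFc.intervalIntegrable _ _)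
      hFc.stronglyMeasurable.stronglyMeasurableAtFilter hFc.continuousAt
  have hGs : ContDiffOn ℝ ∞ G (Icc (-ρ) ρ) := by
    have : ContDiffOn ℝ (∞ + 1) G (Icc (-ρ) ρ) := by
      rw [contDiffOn_succ_iff_derivWithin (uniqueDiffOn_Icc hρ)]
      refine ⟨fun σ _ => (hGd σ).differentiableAt.differentiableWithinAt, by simp, ?_⟩
      refine hinv.congr fun σ hσ => ?_
      rw [(hGd σ).hasDerivWithinAt.derivWithin (uniqueDiffOn_Icc hρ σ hσ), hFe σ hσ]
    simpa using this
  obtain ⟨B, hB⟩ := isCompact_Icc.exists_bound_of_continuousOn hGs.continuousOn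
  refine ⟨fun x => G (x 1), max B 1, by positivity, ?_, ?_, ?_, ?_⟩
  · exact hGs.comp (t := Icc (-ρ) ρ) (contDiff_apply ℝ ℝ (1 : Fin 2)).contDiffOn (fun _ hx => hx)
  · intro x hx
    have hc : pd ρ 1 (fun y => y 1) x = 1 := by
      unfold pd
      have : HasFDerivAt (fun y : Coord => y 1)
          (ContinuousLinearMap.proj (R := ℝ) (φ := fun _ : Fin 2 => ℝ) 1) x :=
        hasFDerivAt_apply 1 x
      rw [this.hasFDerivWithinAt.fderivWithin (uniqueDiffOn_strip hf.rho_pos x hx)]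
      simp
    unfold sd
    rw [pd_comp hf.rho_pos hx 1 (u := fun y => y 1) (hGd (x 1)) (by fun_prop), hc, hFe _ hx]
    have := (hf.pos' hx).ne'
    field_simp
  · intro x hx
    exact (hB _ hx).trans (le_max_left _ _)
  · intro x _
    simp

/-- If the boundary is strictly concave, the solution grows at least linearly, at a rate that
depends on the initial data only. -/
theorem IsProfile.exists_growth (hf : IsProfile ρ f) (hκ : 0 < κ) :
    ∃ c M : ℝ, 0 < c ∧ ∀ (T : ℝ) (v : ℝ → Coord → ℝ), IsSol ρ T κ f v →
      ∀ t ∈ Ico 0 T, ∀ x ∈ strip ρ, c * t - M ≤ v t x := by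
  obtain ⟨S, B, hB, hSs, hS1, hSB, hSp⟩ := hf.exists_isothermal
  obtain ⟨N, hN0, hN⟩ : ∃ N, 0 < N ∧ ∀ σ ∈ Icc (-ρ) ρ, f σ ≤ N := by
    obtain ⟨N, hN⟩ := isCompact_Icc.exists_bound_of_continuousOn hf.smooth.continuousOn
    exact ⟨max N 1, by positivity,
      fun σ hσ => (le_abs_self _).trans ((hN σ hσ).trans (le_max_left _ _))⟩
  set m := N⁻¹ with hm
  have hm0 : 0 < m := inv_pos.2 hN0
  -- The first bound keeps the slope `2 c S` of the barrier `c S²` within `κ` in absolute value; the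
  -- second gives `2 c S² ≤ m / 2`, half of the lower bound of `v`.
  set c := min (κ / (2 * B)) (m / (4 * B ^ 2)) with hc
  have hc0 : 0 < c := lt_min (by positivity) (by positivity)
  have hc1 : 2 * c * B ≤ κ := by
    have := min_le_left (κ / (2 * B)) (m / (4 * B ^ 2))
    rw [← hc, le_div_iff₀ (by positivity)] at this
    linarith
  have hc2 : 2 * c * B ^ 2 ≤ m / 2 := by
    have := min_le_right (κ / (2 * B)) (m / (4 * B ^ 2))
    rw [← hc, le_div_iff₀ (by positivity)] at this
    linarith
  refine ⟨c * m ^ 2, c * B ^ 2, by positivity, fun T v h t ht => ?_⟩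
  have hIcc : ∀ {s}, s ∈ Icc 0 t → s ∈ Ico 0 T := fun hs => ⟨hs.1, hs.2.trans_lt ht.2⟩
  have hv0 : ∀ x ∈ strip ρ, m ≤ v 0 x := fun x hx => by
    rw [h.init x hx]; exact inv_anti₀ (hf.pos' hx) (hN _ hx)
  -- At a maximum `v_s = 2 c S` and `v_ss ≥ 2 c`, whence `v_t ≥ 2 c v (v - 2 c S²) ≥ c m²`, which
  -- outweighs the growth of the linear term.
  have key := max_principle hf.rho_pos (a := 0) (b := t) (M := c * B ^ 2)
    (z := fun t x => c * (S x * S x) - v t x + c * m ^ 2 * t) ?_ ?_ ?_ ?_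
  · intro x hx
    have := key t ⟨ht.1, le_rfl⟩ x hx
    have := mul_nonneg hc0.le (mul_self_nonneg (S x))
    linarith
  · refine ContinuousOn.mono (s := Ico 0 T ×ˢ strip ρ) ?_ (prod_mono_left fun _ hs => hIcc hs)
    have hSc : ContinuousOn (fun p : ℝ × Coord => S p.2) (Ico 0 T ×ˢ strip ρ) :=
      hSs.continuousOn.comp continuous_snd.continuousOn fun _ hp => hp.2
    exact ((continuousOn_const.mul (hSc.mul hSc)).sub h.cont).add (by fun_prop)
  · intro s hs x hx
    simp only [hSp x hx, h.per s (hIcc hs) x hx]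
  · intro x hx
    have h1 : S x * S x ≤ B ^ 2 := by
      rw [← abs_mul_abs_self]; nlinarith [hSB x hx, abs_nonneg (S x)]
    have := mul_le_mul_of_nonneg_left h1 hc0.le
    have := (h.pos 0 ⟨le_rfl, h.T_pos⟩ x hx)
    linarith
  · intro s hs x hx hmax _
    have hs' : s ∈ Ioo 0 T := ⟨hs.1, hs.2.trans_lt ht.2⟩
    have hs'' : s ∈ Ico 0 T := ⟨hs'.1.le, hs'.2⟩
    have s0 := h.slice hs''
    have s1 := hf.contDiffOn_sd s0
    have hb0 := h.boundary s hs' x hx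
    have cc : ContDiffOn ℝ ∞ (fun _ : Coord => c) (strip ρ) := contDiffOn_const
    have hsc : ∀ a y, sd ρ f (fun _ => a) y = 0 := fun a y => by simp [sd, pd_const]
    have ct : ContDiffOn ℝ ∞ (fun _ : Coord => c * m ^ 2 * s) (strip ρ) := contDiffOn_const
    have D1 : ∀ y ∈ strip ρ, sd ρ f (fun x => c * (S x * S x) - v s x + c * m ^ 2 * s) y =
        2 * c * S y - sd ρ f (v s) y := by
      intro y hy
      rw [hf.sd_add ((cc.mul (hSs.mul hSs)).sub s0) ct hy, hf.sd_sub (cc.mul (hSs.mul hSs)) s0 hy,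
        hf.sd_mul cc (hSs.mul hSs) hy, hf.sd_mul hSs hSs hy, hsc, hsc, hS1 y hy]
      ring
    have D2 : sd ρ f (sd ρ f (fun x => c * (S x * S x) - v s x + c * m ^ 2 * s)) x =
        2 * c - sd ρ f (sd ρ f (v s)) x := by
      have c2 : ContDiffOn ℝ ∞ (fun _ : Coord => 2 * c) (strip ρ) := contDiffOn_const
      rw [IsProfile.sd_congr D1 hx, hf.sd_sub (c2.mul hSs) s1 hx, hf.sd_mul c2 hSs hx, hsc,
        hS1 x hx]
      ring
    have hSx := abs_le.1 (hSB x hx)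
    obtain ⟨t1, t2⟩ := hf.sd_max_test (((cc.mul (hSs.mul hSs)).sub s0).add ct) hx hmax
      (fun e => by
        rw [D1 x hx, hb0.1 e]
        nlinarith [mul_le_mul_of_nonneg_left hSx.2 hc0.le])
      (fun e => by
        rw [D1 x hx, hb0.2 e]
        nlinarith [mul_le_mul_of_nonneg_left hSx.1 hc0.le])
    rw [D1 x hx] at t1
    rw [D2] at t2
    have hd := ((h.hasDerivAt hs' hx).const_sub (c * (S x * S x))).add
      ((hasDerivAt_id s).const_mul (c * m ^ 2))
    refine ⟨_, ?_, hd⟩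
    have hvm := h.mono_min le_rfl hs'.1.le hs'.2 hv0 x hx
    have hV := h.pos s hs'' x hx
    have hp : sd ρ f (v s) x = 2 * c * S x := by linarith
    rw [hp]
    set V := v s x
    set w := sd ρ f (sd ρ f (v s)) x
    have i1 : V ^ 2 * (2 * c) ≤ V ^ 2 * w := mul_le_mul_of_nonneg_left (by linarith) (sq_nonneg V)
    have hS2 : S x ^ 2 ≤ B ^ 2 := sq_le_sq' hSx.1 hSx.2
    have i2 : 2 * c * S x ^ 2 ≤ m / 2 :=
      (mul_le_mul_of_nonneg_left hS2 (by positivity)).trans hc2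
    have i3 : m / 2 ≤ V - 2 * c * S x ^ 2 := by linarith
    have i4 : m * (m / 2) ≤ V * (V - 2 * c * S x ^ 2) :=
      mul_le_mul hvm i3 (by positivity) hV.le
    have i5 := mul_le_mul_of_nonneg_left i4 (show 0 ≤ 2 * c by positivity)
    nlinarith

end CylinderFlow

/-! ### Curvature and area of the conformal metrics. -/

namespace CylinderFlow

variable {ρ T κ : ℝ} {f : ℝ → ℝ}

theorem pd_one_comp (hρ : 0 < ρ) {w : ℝ → ℝ} (hw : DifferentiableOn ℝ w (Icc (-ρ) ρ)) {x : Coord}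
    (hx : x ∈ strip ρ) : pd ρ 1 (fun y => w (y 1)) x = derivWithin w (Icc (-ρ) ρ) (x 1) := by
  have h1 : HasFDerivWithinAt (fun y : Coord => y 1)
      (ContinuousLinearMap.proj (R := ℝ) (φ := fun _ : Fin 2 => ℝ) 1) (strip ρ) x :=
    (hasFDerivAt_apply (1 : Fin 2) x).hasFDerivWithinAt
  have h2 := ((hw _ hx).hasDerivWithinAt).comp_hasFDerivWithinAt x h1 (fun y hy => hy)
  have h3 := h2.fderivWithin (uniqueDiffOn_strip hρ x hx)
  unfold pd
  have e : (fun y : Coord => w (y 1)) = w ∘ fun y : Coord => y 1 := rfl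
  rw [e, h3]; simp

theorem pd_zero_comp (w : ℝ → ℝ) (hw : ContDiffOn ℝ ∞ (fun y : Coord => w (y 1)) (strip ρ))
    {x : Coord} (hx : x ∈ strip ρ) : pd ρ 0 (fun y => w (y 1)) x = 0 :=
  pd_zero_of_invariant hw (fun a x _ => by simp) x hx

section Curvature

variable {v : Coord → ℝ} {g : TensorField} {x : Coord}

/-- The metric `g` is `v⁻² (dθ² + dσ² / f²)`. -/
def IsConformal (ρ : ℝ) (f : ℝ → ℝ) (v : Coord → ℝ) (g : TensorField) : Prop :=
  ∀ x ∈ strip ρ, 0 < v x ∧ g x = !![(v x ^ 2)⁻¹, 0; 0, ((v x * f (x 1)) ^ 2)⁻¹]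

theorem IsConformal.inv (hg : IsConformal ρ f v g) (hf : IsProfile ρ f) (hx : x ∈ strip ρ) :
    (g x)⁻¹ = !![v x ^ 2, 0; 0, (v x * f (x 1)) ^ 2] := by
  have h1 := (hg x hx).1.ne'
  have h2 := (hf.pos' hx).ne'
  refine Matrix.inv_eq_right_inv ?_
  rw [(hg x hx).2, Matrix.mul_fin_two, Matrix.one_fin_two]
  congr! 2 <;> simp [h1, h2]

theorem pd_inv_sq (hρ : 0 < ρ) (hx : x ∈ strip ρ) (i : Fin 2) {u : Coord → ℝ} (h0 : u x ≠ 0)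
    (hu : ContDiffOn ℝ ∞ u (strip ρ)) :
    pd ρ i (fun y => (u y ^ 2)⁻¹) x = -2 * pd ρ i u x / u x ^ 3 := by
  have h1 := ((hasDerivAt_pow 2 (u x)).inv (pow_ne_zero 2 h0))
  rw [pd_comp hρ hx i (ψ := fun z => (z ^ 2)⁻¹) h1 (hu.differentiableOn (by simp) x hx)]
  field_simp
  simp
  ring

theorem pd_div (hρ : 0 < ρ) (hx : x ∈ strip ρ) (i : Fin 2) {u w : Coord → ℝ} (h0 : w x ≠ 0)
    (hu : ContDiffOn ℝ ∞ u (strip ρ)) (hw : ContDiffOn ℝ ∞ w (strip ρ)) :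
    pd ρ i (fun y => u y * (w y)⁻¹) x = pd ρ i u x / w x - u x * pd ρ i w x / w x ^ 2 := by
  have hw' := hw.differentiableOn (by simp) x hx
  rw [pd_mul hρ hx i (hu.differentiableOn (by simp) x hx) (hw'.fun_inv h0),
    pd_comp hρ hx i (hasDerivAt_inv h0) hw']
  field_simp
  ring

theorem IsConformal.pd_entries (hg : IsConformal ρ f v g) (hf : IsProfile ρ f)
    (hv : ContDiffOn ℝ ∞ v (strip ρ)) (hx : x ∈ strip ρ) (i : Fin 2) :
    pd ρ i (fun y => g y 0 0) x = -2 * pd ρ i v x / v x ^ 3 ∧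
    pd ρ i (fun y => g y 0 1) x = 0 ∧ pd ρ i (fun y => g y 1 0) x = 0 ∧
    pd ρ i (fun y => g y 1 1) x =
      -2 * (pd ρ i v x * f (x 1) + v x * pd ρ i (fun y => f (y 1)) x) / (v x * f (x 1)) ^ 3 := by
  have h1 := (hg x hx).1.ne'
  have h2 := (hf.pos' hx).ne'
  have hρ := hf.rho_pos
  refine ⟨?_, ?_, ?_, ?_⟩
  · rw [pd_congr (w := fun y => (v y ^ 2)⁻¹) (fun y hy => by rw [(hg y hy).2]; rfl) hx,
      pd_inv_sq hρ hx i h1 hv]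
  · rw [pd_congr (w := fun _ => 0) (fun y hy => by rw [(hg y hy).2]; rfl) hx, pd_const]
  · rw [pd_congr (w := fun _ => 0) (fun y hy => by rw [(hg y hy).2]; rfl) hx, pd_const]
  · rw [pd_congr (w := fun y => ((v y * f (y 1)) ^ 2)⁻¹)
        (fun y hy => by rw [(hg y hy).2]; rfl) hx,
      pd_inv_sq hρ hx i (mul_ne_zero h1 h2) (hv.mul hf.contDiffOn),
      pd_mul hρ hx i (hv.differentiableOn (by simp) x hx)
        (hf.contDiffOn.differentiableOn (by simp) x hx)]

theorem IsConformal.christoffel_eq (hg : IsConformal ρ f v g) (hf : IsProfile ρ f)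
    (hv : ContDiffOn ℝ ∞ v (strip ρ)) (hx : x ∈ strip ρ) :
    (christoffel ρ g 0 0 0 x = -(pd ρ 0 v x * (v x)⁻¹) ∧
      christoffel ρ g 0 0 1 x = -(pd ρ 1 v x * (v x)⁻¹) ∧
      christoffel ρ g 0 1 0 x = -(pd ρ 1 v x * (v x)⁻¹) ∧
      christoffel ρ g 0 1 1 x = pd ρ 0 v x * (v x)⁻¹ * (f (x 1) ^ 2)⁻¹) ∧
    christoffel ρ g 1 0 0 x = pd ρ 1 v x * (v x)⁻¹ * (f (x 1) * f (x 1)) ∧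
      christoffel ρ g 1 0 1 x = -(pd ρ 0 v x * (v x)⁻¹) ∧
      christoffel ρ g 1 1 0 x = -(pd ρ 0 v x * (v x)⁻¹) ∧
      christoffel ρ g 1 1 1 x = -(pd ρ 1 v x * (v x)⁻¹) -
        pd ρ 1 (fun y => f (y 1)) x * (f (x 1))⁻¹ := by
  have h1 := (hg x hx).1.ne'
  have h2 := (hf.pos' hx).ne'
  obtain ⟨a1, a2, a3, a4⟩ := hg.pd_entries hf hv hx 0
  obtain ⟨b1, b2, b3, b4⟩ := hg.pd_entries hf hv hx 1
  have hz : pd ρ 0 (fun y => f (y 1)) x = 0 := pd_zero_comp f hf.contDiffOn hx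
  rw [hz] at a4
  simp only [christoffel, Fin.sum_univ_two, hg.inv hf hx, a1, a2, a3, a4, b1, b2, b3, b4,
    Matrix.of_apply, Matrix.cons_val', Matrix.cons_val_zero, Matrix.cons_val_one,
    Matrix.cons_val_fin_one]
  refine ⟨⟨?_, ?_, ?_, ?_⟩, ?_, ?_, ?_, ?_⟩ <;> field_simp <;> ring

/-- The scalar curvature of a conformal metric. -/
theorem IsConformal.scalarCurvature_eq (hg : IsConformal ρ f v g) (hf : IsProfile ρ f)
    (hv : ContDiffOn ℝ ∞ v (strip ρ)) (hx : x ∈ strip ρ) :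
    scalarCurvature ρ g x = 2 * (v x * (pd ρ 0 (pd ρ 0 v) x + sd ρ f (sd ρ f v) x) -
      (pd ρ 0 v x ^ 2 + sd ρ f v x ^ 2)) := by
  have h1 := (hg x hx).1.ne'
  have h2 := (hf.pos' hx).ne'
  have hρ := hf.rho_pos
  have hz : pd ρ 0 (fun y => f (y 1)) x = 0 := pd_zero_comp f hf.contDiffOn hx
  obtain ⟨⟨a1, a2, a3, a4⟩, a5, a6, a7, a8⟩ := hg.christoffel_eq hf hv hx
  have q1 : ∀ i j, ContDiffOn ℝ ∞ (fun y => pd ρ i v y * (v y)⁻¹) (strip ρ) ∧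
      pd ρ j (fun y => pd ρ i v y * (v y)⁻¹) x = pd ρ j (pd ρ i v) x / v x -
        pd ρ i v x * pd ρ j v x / v x ^ 2 := fun i j =>
    ⟨(contDiffOn_pd hρ hv i).mul (hv.inv fun y hy => (hg y hy).1.ne'),
      pd_div hρ hx j h1 (contDiffOn_pd hρ hv i) hv⟩
  have d1 : pd ρ 1 (christoffel ρ g 1 0 0) x = (pd ρ 1 (pd ρ 1 v) x / v x -
      pd ρ 1 v x * pd ρ 1 v x / v x ^ 2) * (f (x 1) * f (x 1)) + pd ρ 1 v x * (v x)⁻¹ *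
        (2 * f (x 1) * pd ρ 1 (fun y => f (y 1)) x) := by
    have hφ := hf.contDiffOn.differentiableOn (by simp) x hx
    rw [pd_congr (fun y hy => (hg.christoffel_eq hf hv hy).2.1) hx,
      pd_mul hρ hx 1 ((q1 1 1).1.differentiableOn (by simp) x hx) (hφ.fun_mul hφ), (q1 1 1).2,
      pd_mul hρ hx 1 hφ hφ]
    ring
  have d2 : pd ρ 0 (christoffel ρ g 1 1 0) x = -(pd ρ 0 (pd ρ 0 v) x / v x -
      pd ρ 0 v x * pd ρ 0 v x / v x ^ 2) := by
    rw [pd_congr (fun y hy => (hg.christoffel_eq hf hv hy).2.2.2.1) hx, pd_neg hρ hx, (q1 0 0).2]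
  have d3 : pd ρ 1 (christoffel ρ g 0 0 1) x = -(pd ρ 1 (pd ρ 1 v) x / v x -
      pd ρ 1 v x * pd ρ 1 v x / v x ^ 2) := by
    rw [pd_congr (fun y hy => (hg.christoffel_eq hf hv hy).1.2.1) hx, pd_neg hρ hx, (q1 1 1).2]
  have d4 : pd ρ 0 (christoffel ρ g 0 1 1) x = (pd ρ 0 (pd ρ 0 v) x / v x -
      pd ρ 0 v x * pd ρ 0 v x / v x ^ 2) * (f (x 1) ^ 2)⁻¹ := by
    have hs : ContDiffOn ℝ ∞ (fun y : Coord => (f (y 1) ^ 2)⁻¹) (strip ρ) :=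
      (hf.contDiffOn.pow 2).inv fun y hy => pow_ne_zero 2 (hf.pos' hy).ne'
    rw [pd_congr (fun y hy => (hg.christoffel_eq hf hv hy).1.2.2.2) hx,
      pd_mul hρ hx 0 ((q1 0 0).1.differentiableOn (by simp) x hx)
        (hs.differentiableOn (by simp) x hx), (q1 0 0).2,
      pd_zero_comp (fun z => (f z ^ 2)⁻¹) hs hx]
    ring
  rw [hf.sd_sd hv hx]
  simp only [sd, scalarCurvature, ricci, Fin.sum_univ_two, hg.inv hf hx, a1, a2, a3, a4, a5, a6,
    a7, a8, d1, d2, d3, d4, Matrix.of_apply, Matrix.cons_val', Matrix.cons_val_zero,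
    Matrix.cons_val_one, Matrix.cons_val_fin_one, zero_mul]
  field_simp
  ring

/-- The factors of `v` cancel, since `√g¹¹ = v f`; this is why prescribing the curvature of the
boundary is a linear Neumann condition for `v`. -/
theorem IsConformal.geodesicCurvature_eq (hg : IsConformal ρ f v g) (hf : IsProfile ρ f)
    (hv : ContDiffOn ℝ ∞ v (strip ρ)) (hx : x ∈ strip ρ) :
    geodesicCurvature ρ g x = -(Real.sign (x 1)) * sd ρ f v x := by
  have h1 := (hg x hx).1
  have h2 := hf.pos' hx
  have e : √((v x * f (x 1)) ^ 2) = v x * f (x 1) := Real.sqrt_sq (by positivity)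
  simp only [geodesicCurvature, (hg.christoffel_eq hf hv hx).2.1, hg.inv hf hx]
  simp only [(hg x hx).2, Matrix.of_apply, Matrix.cons_val', Matrix.cons_val_zero,
    Matrix.cons_val_one, Matrix.cons_val_fin_one, e, sd]
  field_simp

end Curvature

theorem isConformal_rotMetric (hf : IsProfile ρ f) :
    IsConformal ρ f (fun x => (f (x 1))⁻¹) (rotMetric f) := by
  intro x hx
  have h2 := hf.pos' hx
  refine ⟨inv_pos.2 h2, ?_⟩
  simp [rotMetric, h2.ne']

/-- The area in terms of the conformal factor. -/
theorem IsSol.area_eq {v : ℝ → Coord → ℝ} (h : IsSol ρ T κ f v) {t : ℝ} (ht : t ∈ Ico 0 T)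
    {g : TensorField} (hg : IsConformal ρ f (v t) g) :
    area ρ g = 2 * Real.pi * ∫ σ in (-ρ)..ρ, (v t ![0, σ] ^ 2 * f σ)⁻¹ := by
  have hρ : -ρ ≤ ρ := by linarith [h.profile.rho_pos]
  have h1 : ∀ θ, ∫ σ in (-ρ)..ρ, √((g ![θ, σ]).det) =
      ∫ σ in (-ρ)..ρ, (v t ![0, σ] ^ 2 * f σ)⁻¹ := by
    intro θ
    refine intervalIntegral.integral_congr fun σ hσ => ?_
    rw [uIcc_of_le hρ] at hσ
    have hm : (![θ, σ] : Coord) ∈ strip ρ := hσ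
    have hm0 : (![0, σ] : Coord) ∈ strip ρ := hσ
    have e : v t ![θ, σ] = v t ![0, σ] := by
      rw [← h.rotate_eq θ ht hm0]
      congr 1
      ext i; fin_cases i <;> simp
    have h2 := h.profile.pos σ hσ
    have h3 := h.pos t ht _ hm0
    simp only [(hg _ hm).2, Matrix.det_fin_two_of, e]
    rw [Real.sqrt_eq_iff_mul_self_eq_of_pos (by positivity)]
    simp
    field_simp
  simp only [area, h1, intervalIntegral.integral_const, smul_eq_mul, sub_zero]

theorem IsSol.continuousOn_area_density {v : ℝ → Coord → ℝ} (h : IsSol ρ T κ f v) {t : ℝ}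
    (ht : t ∈ Ico 0 T) :
    ContinuousOn (fun σ => (v t ![0, σ] ^ 2 * f σ)⁻¹) (uIcc (-ρ) ρ) := by
  have hρ : -ρ ≤ ρ := by linarith [h.profile.rho_pos]
  rw [uIcc_of_le hρ]
  have hc : Continuous fun σ : ℝ => (![0, σ] : Coord) := by
    refine continuous_pi fun i => ?_
    fin_cases i
    · exact continuous_const
    · exact continuous_id
  have h1 : ContinuousOn (fun σ : ℝ => v t ![0, σ]) (Icc (-ρ) ρ) :=
    (h.slice ht).continuousOn.comp hc.continuousOn fun σ hσ => hσ
  refine ((h1.pow 2).mul h.profile.smooth.continuousOn).inv₀ fun σ hσ => ?_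
  have h2 := h.profile.pos σ hσ
  have h3 := h.pos t ht ![0, σ] hσ
  simp only [Pi.mul_apply, Pi.pow_apply]
  positivity

/-- The area density is `(v² f)⁻¹`. With the companion lower bound this makes the area comparable to
`V⁻²` when `v` is comparable to `V`. -/
theorem IsSol.area_le {v : ℝ → Coord → ℝ} (h : IsSol ρ T κ f v) {t : ℝ} (ht : t ∈ Ico 0 T)
    {g : TensorField} (hg : IsConformal ρ f (v t) g) {V a : ℝ} (hV : 0 < V) (ha : 0 < a)
    (hvV : ∀ x ∈ strip ρ, V ≤ v t x) (hfa : ∀ σ ∈ Icc (-ρ) ρ, a ≤ f σ) :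
    area ρ g ≤ 4 * Real.pi * ρ / (V ^ 2 * a) := by
  have hρ : -ρ ≤ ρ := by linarith [h.profile.rho_pos]
  have h1 := intervalIntegral.integral_mono_on (μ := MeasureTheory.volume) hρ
    (h.continuousOn_area_density ht).intervalIntegrable
    (intervalIntegrable_const (c := (V ^ 2 * a)⁻¹)) (fun σ hσ =>
      inv_anti₀ (by positivity) (mul_le_mul
        (pow_le_pow_left₀ hV.le (hvV ![0, σ] hσ) 2) (hfa σ hσ) ha.le (sq_nonneg _)))
  rw [intervalIntegral.integral_const, smul_eq_mul] at h1
  rw [h.area_eq ht hg]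
  refine (mul_le_mul_of_nonneg_left h1 (by positivity)).trans (le_of_eq ?_)
  field_simp
  ring

theorem IsSol.le_area {v : ℝ → Coord → ℝ} (h : IsSol ρ T κ f v) {t : ℝ} (ht : t ∈ Ico 0 T)
    {g : TensorField} (hg : IsConformal ρ f (v t) g) {V N : ℝ} (hV : 0 < V) (hN : 0 < N)
    (hvV : ∀ x ∈ strip ρ, v t x ≤ V) (hfN : ∀ σ ∈ Icc (-ρ) ρ, f σ ≤ N) :
    4 * Real.pi * ρ / (V ^ 2 * N) ≤ area ρ g := by
  have hρ : -ρ ≤ ρ := by linarith [h.profile.rho_pos]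
  have h1 := intervalIntegral.integral_mono_on (μ := MeasureTheory.volume) hρ
    (intervalIntegrable_const (c := (V ^ 2 * N)⁻¹))
    (h.continuousOn_area_density ht).intervalIntegrable (fun σ hσ => by
      have h2 := h.profile.pos σ hσ
      have h3 := h.pos t ht ![0, σ] hσ
      exact inv_anti₀ (by positivity) (mul_le_mul
        (pow_le_pow_left₀ h3.le (hvV ![0, σ] hσ) 2) (hfN σ hσ) h2.le (sq_nonneg _)))
  rw [intervalIntegral.integral_const, smul_eq_mul] at h1
  rw [h.area_eq ht hg]
  refine le_trans (le_of_eq ?_) (mul_le_mul_of_nonneg_left h1 (by positivity))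
  field_simp
  ring

end CylinderFlow

/-! ### From the tensor flow to the scalar problem. -/

namespace CylinderFlow

variable {ρ T κ : ℝ} {f : ℝ → ℝ}

theorem IsProfile.derivWithin_smooth (hf : IsProfile ρ f) :
    ContDiffOn ℝ ∞ (derivWithin f (Icc (-ρ) ρ)) (Icc (-ρ) ρ) :=
  hf.smooth.derivWithin (uniqueDiffOn_Icc (by linarith [hf.rho_pos])) (by simp)

theorem IsProfile.sd_inv_eq (hf : IsProfile ρ f) {x : Coord} (hx : x ∈ strip ρ) :
    sd ρ f (fun x => (f (x 1))⁻¹) x = -(derivWithin f (Icc (-ρ) ρ) (x 1) * (f (x 1))⁻¹) := by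
  have h2 := (hf.pos' hx).ne'
  rw [hf.sd_inv hf.contDiffOn h2 hx, sd,
    pd_one_comp hf.rho_pos (hf.smooth.differentiableOn (by simp)) hx]
  field_simp

/-- The scalar curvature of `dσ² + f² dθ²` is `-2 f'' / f`, so its nonnegativity is the concavity of
`f`. -/
theorem IsProfile.derivWithin_antitone (hf : IsProfile ρ f)
    (hR : ∀ x ∈ strip ρ, 0 ≤ scalarCurvature ρ (rotMetric f) x) :
    AntitoneOn (derivWithin f (Icc (-ρ) ρ)) (Icc (-ρ) ρ) := by
  have hρ := hf.rho_pos
  have hs := hf.derivWithin_smooth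
  refine antitoneOn_of_deriv_nonpos (convex_Icc _ _) hs.continuousOn
    ((hs.differentiableOn (by simp)).mono interior_subset) fun σ hσ => ?_
  rw [interior_Icc] at hσ
  have hx : (![0, σ] : Coord) ∈ strip ρ := Ioo_subset_Icc_self hσ
  have h2 := hf.pos' hx
  have h3 := hR _ hx
  have hd : ContDiffOn ℝ ∞ (fun x : Coord => derivWithin f (Icc (-ρ) ρ) (x 1)) (strip ρ) :=
    hs.comp (t := Icc (-ρ) ρ) (contDiff_apply ℝ ℝ (1 : Fin 2)).contDiffOn (fun _ hx => hx)
  have hz : pd ρ 0 (pd ρ 0 fun x => (f (x 1))⁻¹) ![0, σ] = 0 := by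
    rw [pd_congr (w := fun _ => 0) (fun y hy => pd_zero_comp (fun z => (f z)⁻¹)
      hf.contDiffOn_inv hy) hx, pd_const]
  rw [(isConformal_rotMetric hf).scalarCurvature_eq hf hf.contDiffOn_inv hx, hz,
    pd_zero_comp (fun z => (f z)⁻¹) hf.contDiffOn_inv hx,
    IsProfile.sd_congr (fun y hy => hf.sd_inv_eq hy) hx,
    hf.sd_neg hx, hf.sd_mul hd hf.contDiffOn_inv hx, hf.sd_inv_eq hx, sd,
    pd_one_comp hρ (hs.differentiableOn (by simp)) hx] at h3
  simp only [Matrix.cons_val_one, Matrix.cons_val_fin_one] at h2 h3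
  rw [derivWithin_of_mem_nhds (f := derivWithin f (Icc (-ρ) ρ)) (Icc_mem_nhds hσ.1 hσ.2)] at h3
  set d := deriv (derivWithin f (Icc (-ρ) ρ)) σ
  have e : ∀ a b : ℝ, 2 * ((f σ)⁻¹ * (0 + -(f σ * d * (f σ)⁻¹ + a * -(a * (f σ)⁻¹))) -
      (0 ^ 2 + (-(a * (f σ)⁻¹)) ^ 2)) = -(2 * (f σ)⁻¹) * d := by
    intro a b; field_simp; ring
  rw [e _ 0] at h3
  have : 0 < 2 * (f σ)⁻¹ := by positivity
  by_contra hc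
  push Not at hc
  nlinarith [mul_pos this hc]

theorem IsProfile.derivWithin_neg_rho (hf : IsProfile ρ f)
    (heven : ∀ σ ∈ Icc (-ρ) ρ, f (-σ) = f σ) :
    derivWithin f (Icc (-ρ) ρ) (-ρ) = -derivWithin f (Icc (-ρ) ρ) ρ := by
  have hρ := hf.rho_pos
  have hm : -ρ ∈ Icc (-ρ) ρ := ⟨le_rfl, by linarith⟩
  have hm' : ρ ∈ Icc (-ρ) ρ := ⟨by linarith, le_rfl⟩
  have hu := uniqueDiffOn_Icc (show -ρ < ρ by linarith)
  have h1 : HasDerivWithinAt f (derivWithin f (Icc (-ρ) ρ) ρ) (Icc (-ρ) ρ) (- -ρ) := by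
    rw [neg_neg]
    exact (hf.smooth.differentiableOn (by simp) _ hm').hasDerivWithinAt
  have h2 : HasDerivWithinAt (fun σ : ℝ => -σ) (-1) (Icc (-ρ) ρ) (-ρ) :=
    (hasDerivAt_neg (-ρ)).hasDerivWithinAt
  have h3 := HasDerivWithinAt.comp (-ρ) h1 h2 fun σ hσ => (⟨by linarith [hσ.2], by linarith [hσ.1]⟩ : -σ ∈ Icc (-ρ) ρ)
  have h4 := h3.congr (f₁ := f) (fun σ hσ => (heven σ hσ).symm) (heven _ hm).symm
  rw [h4.derivWithin (hu _ hm)]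
  simp

/-- The geodesic curvature of the boundary is nonpositive, and the metric is flat if it vanishes. -/
theorem IsProfile.boundary_sign (hf : IsProfile ρ f)
    (heven : ∀ σ ∈ Icc (-ρ) ρ, f (-σ) = f σ)
    (hR : ∀ x ∈ strip ρ, 0 ≤ scalarCurvature ρ (rotMetric f) x) :
    ∃ κ, 0 ≤ κ ∧
      (∀ x ∈ strip ρ, (x 1 = ρ → sd ρ f (fun x => (f (x 1))⁻¹) x = κ) ∧
        (x 1 = -ρ → sd ρ f (fun x => (f (x 1))⁻¹) x = -κ)) ∧
      (κ = 0 → ∀ x ∈ strip ρ, sd ρ f (fun x => (f (x 1))⁻¹) x = 0) := by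
  have hρ := hf.rho_pos
  have hm : -ρ ∈ Icc (-ρ) ρ := ⟨le_rfl, by linarith⟩
  have hm' : ρ ∈ Icc (-ρ) ρ := ⟨by linarith, le_rfl⟩
  have hanti := hf.derivWithin_antitone hR
  have hneg := hf.derivWithin_neg_rho heven
  have h1 := hanti hm hm' (by linarith)
  have hfp := hf.pos _ hm'
  refine ⟨-(derivWithin f (Icc (-ρ) ρ) ρ * (f ρ)⁻¹), ?_, fun x hx => ⟨fun e => ?_, fun e => ?_⟩,
    fun hz x hx => ?_⟩
  · have : derivWithin f (Icc (-ρ) ρ) ρ ≤ 0 := by linarith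
    have := mul_nonpos_of_nonpos_of_nonneg this (inv_pos.2 hfp).le
    linarith
  · rw [hf.sd_inv_eq hx, e]
  · rw [hf.sd_inv_eq hx, e, hneg, heven _ hm']
    ring
  · have h0 : derivWithin f (Icc (-ρ) ρ) ρ = 0 := by
      have := neg_eq_zero.1 hz
      exact (mul_eq_zero.1 this).resolve_right (inv_pos.2 hfp).ne'
    have i1 := hanti hm hx hx.1
    have i2 := hanti hx hm' hx.2
    have : derivWithin f (Icc (-ρ) ρ) (x 1) = 0 := by linarith
    rw [hf.sd_inv_eq hx, this]; simp

/-- The conformal factor of a flow that starts from `dσ² + f² dθ²`. -/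
noncomputable def conformalFactor (f : ℝ → ℝ) (g : ℝ → TensorField) (t : ℝ) (x : Coord) : ℝ :=
  (√(g t x 1 1))⁻¹ * (f (x 1))⁻¹

namespace IsRicciFlow

variable {T' : EReal} {g : ℝ → TensorField}

theorem diag_pos (h : IsRicciFlow ρ (rotMetric f) T' g) {t : ℝ} (ht : 0 ≤ t) (htT : (t : EReal) < T')
    {x : Coord} (hx : x ∈ strip ρ) : 0 < g t x 1 1 :=
  (h.metric t ht htT x hx).1.diag_pos

/-- The Ricci flow stays in the conformal class of the initial metric. -/
theorem eq_mul_rotMetric (h : IsRicciFlow ρ (rotMetric f) T' g) {t : ℝ} (ht : 0 ≤ t)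
    (htT : (t : EReal) < T') {x : Coord} (hx : x ∈ strip ρ) (i j : Fin 2) :
    g t x i j = g t x 1 1 * rotMetric f x i j := by
  have hlt : ∀ {s : ℝ}, s ≤ t → (s : EReal) < T' := fun hs =>
    lt_of_le_of_lt (EReal.coe_le_coe_iff.2 hs) htT
  have hinit : g 0 x i j / g 0 x 1 1 = rotMetric f x i j := by
    rw [h.initial x hx]; simp [rotMetric]
  rcases eq_or_lt_of_le ht with h0 | h0
  · rw [← h0, h.initial x hx]; simp [rotMetric]
  have hc : ∀ i j, ContinuousOn (fun s => g s x i j) (Icc 0 t) := fun i j =>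
    ContinuousOn.comp (g := fun p : ℝ × Coord => g p.1 p.2 i j) (h.cont i j)
      (f := fun s : ℝ => (s, x)) (by fun_prop) fun s hs => ⟨hs.1, hlt hs.2, hx⟩
  have hne : ∀ s ∈ Icc 0 t, g s x 1 1 ≠ 0 := fun s hs => (h.diag_pos hs.1 (hlt hs.2) hx).ne'
  -- All components satisfy the same linear equation `y' = -R y` at a fixed point, so their ratios
  -- have zero time derivative; the mean value theorem carries this down to `t = 0` by continuity.
  obtain ⟨c, -, hc'⟩ := exists_hasDerivAt_eq_slope (fun s => g s x i j / g s x 1 1) (fun _ => 0) h0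
    ((hc i j).div (hc 1 1) hne) fun s hs => by
      have h1 := h.flow s hs.1 (hlt hs.2.le) x hx
      exact ((h1 i j).div (h1 1 1) (hne s ⟨hs.1.le, hs.2.le⟩)).congr_deriv (by ring)
  have h2 : g t x i j / g t x 1 1 = rotMetric f x i j := by
    rw [eq_comm, div_eq_zero_iff] at hc'
    rcases hc' with hc' | hc'
    · linarith
    · linarith
  rw [← h2, mul_div_cancel₀ _ (hne t ⟨ht, le_rfl⟩)]

theorem isConformal (h : IsRicciFlow ρ (rotMetric f) T' g) (hf : IsProfile ρ f) {t : ℝ}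
    (ht : 0 ≤ t) (htT : (t : EReal) < T') : IsConformal ρ f (conformalFactor f g t) (g t) := by
  intro x hx
  have h1 := h.diag_pos ht htT hx
  have h2 := hf.pos' hx
  have h3 := Real.sqrt_pos.2 h1
  have h4 := Real.sq_sqrt h1.le
  refine ⟨mul_pos (inv_pos.2 h3) (inv_pos.2 h2), ?_⟩
  ext i j
  rw [h.eq_mul_rotMetric ht htT hx]
  fin_cases i <;> fin_cases j <;> simp [rotMetric, conformalFactor, mul_pow, h4, h2.ne', mul_comm]

theorem slice (h : IsRicciFlow ρ (rotMetric f) T' g) {t : ℝ} (ht : 0 ≤ t)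
    (htT : (t : EReal) < T') : ContDiffOn ℝ ∞ (fun y => g t y 1 1) (strip ρ) := by
  rcases eq_or_lt_of_le ht with h0 | h0
  · refine (contDiffOn_const (c := (1 : ℝ))).congr fun y hy => ?_
    rw [← h0, h.initial y hy]; simp [rotMetric]
  · have : ContDiffOn ℝ ∞ (fun y : Coord => (t, y)) (strip ρ) :=
      (contDiff_const.prodMk contDiff_id).contDiffOn
    exact ContDiffOn.comp (g := fun p : ℝ × Coord => g p.1 p.2 1 1) (h.smooth 1 1) this
      (fun y hy => ⟨h0, htT, hy⟩)

end IsRicciFlow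

theorem hasDerivAt_inv_sqrt {z : ℝ} (hz : 0 < z) :
    HasDerivAt (fun z => (√z)⁻¹) (-(1 / 2) * (√z)⁻¹ ^ 3) z := by
  have h3 := Real.sqrt_pos.2 hz
  refine ((Real.hasDerivAt_sqrt hz.ne').fun_inv h3.ne').congr_deriv ?_
  field_simp

section Slices

variable {E : Coord → ℝ} {x : Coord}

theorem contDiffOn_inv_sqrt (hE : ContDiffOn ℝ ∞ E (strip ρ)) (hpos : ∀ y ∈ strip ρ, 0 < E y) :
    ContDiffOn ℝ ∞ (fun y => (√(E y))⁻¹) (strip ρ) :=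
  (hE.sqrt fun y hy => (hpos y hy).ne').inv fun y hy => (Real.sqrt_pos.2 (hpos y hy)).ne'

theorem pd_inv_sqrt (hρ : 0 < ρ) (hE : ContDiffOn ℝ ∞ E (strip ρ))
    (hpos : ∀ y ∈ strip ρ, 0 < E y) (hx : x ∈ strip ρ) (i : Fin 2) :
    pd ρ i (fun y => (√(E y))⁻¹) x = -(1 / 2) * (√(E x))⁻¹ ^ 3 * pd ρ i E x :=
  pd_comp hρ hx i (hasDerivAt_inv_sqrt (hpos x hx)) (hE.differentiableOn (by simp) x hx)

theorem pd_pd_inv_sqrt (hρ : 0 < ρ) (hE : ContDiffOn ℝ ∞ E (strip ρ))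
    (hpos : ∀ y ∈ strip ρ, 0 < E y) (hx : x ∈ strip ρ) (i : Fin 2) :
    pd ρ i (pd ρ i fun y => (√(E y))⁻¹) x =
      3 / 4 * (√(E x))⁻¹ ^ 5 * pd ρ i E x ^ 2 - 1 / 2 * (√(E x))⁻¹ ^ 3 * pd ρ i (pd ρ i E) x := by
  have hh := contDiffOn_inv_sqrt hE hpos
  have h3 : pd ρ i (fun y => -(1 / 2) * (√(E y))⁻¹ ^ 3) x =
      (-(3 / 2) * (√(E x))⁻¹ ^ 2) * pd ρ i (fun y => (√(E y))⁻¹) x := by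
    refine pd_comp hρ hx i (ψ := fun z => -(1 / 2) * z ^ 3) ?_ (hh.differentiableOn (by simp) x hx)
    refine ((hasDerivAt_pow 3 ((√(E x))⁻¹)).const_mul (-(1 / 2))).congr_deriv ?_
    push_cast; ring
  have hs : ContDiffOn ℝ ∞ (fun y => -(1 / 2) * (√(E y))⁻¹ ^ 3) (strip ρ) :=
    contDiffOn_const.mul (hh.pow 3)
  rw [pd_congr (fun y hy => pd_inv_sqrt hρ hE hpos hy i) hx,
    pd_mul hρ hx i (hs.differentiableOn (by simp) x hx)
      ((contDiffOn_pd hρ hE i).differentiableOn (by simp) x hx), h3, pd_inv_sqrt hρ hE hpos hx]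
  ring

theorem pd_pd_mul (hρ : 0 < ρ) {u w : Coord → ℝ} (hu : ContDiffOn ℝ ∞ u (strip ρ))
    (hw : ContDiffOn ℝ ∞ w (strip ρ)) (hx : x ∈ strip ρ) (i : Fin 2) :
    pd ρ i (pd ρ i fun y => u y * w y) x = pd ρ i (pd ρ i u) x * w x +
      2 * (pd ρ i u x * pd ρ i w x) + u x * pd ρ i (pd ρ i w) x := by
  have du := hu.differentiableOn (by simp)
  have dw := hw.differentiableOn (by simp)
  have du1 := (contDiffOn_pd hρ hu i).differentiableOn (by simp)
  have dw1 := (contDiffOn_pd hρ hw i).differentiableOn (by simp)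
  rw [pd_congr (fun y hy => pd_mul hρ hy i (du y hy) (dw y hy)) hx,
    pd_add hρ hx i ((du1 x hx).fun_mul (dw x hx)) ((du x hx).fun_mul (dw1 x hx)),
    pd_mul hρ hx i (du1 x hx) (dw x hx), pd_mul hρ hx i (du x hx) (dw1 x hx)]
  ring

end Slices

/-- The conformal factor of a Ricci flow is a solution of the scalar problem. -/
theorem IsRicciFlow.isSol {T' : EReal} {g : ℝ → TensorField}
    (h : IsRicciFlow ρ (rotMetric f) T' g) (hf : IsProfile ρ f) (hκ : 0 ≤ κ)
    (hbd : ∀ x ∈ strip ρ, (x 1 = ρ → sd ρ f (fun x => (f (x 1))⁻¹) x = κ) ∧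
        (x 1 = -ρ → sd ρ f (fun x => (f (x 1))⁻¹) x = -κ))
    (hT : 0 < T) (hTT' : (T : EReal) < T') : IsSol ρ T κ f (conformalFactor f g) := by
  have hρ := hf.rho_pos
  have hlt : ∀ {s : ℝ}, s < T → (s : EReal) < T' := fun hs =>
    (EReal.coe_lt_coe_iff.2 hs).trans hTT'
  have hpos : ∀ t ∈ Ico 0 T, ∀ x ∈ strip ρ, 0 < g t x 1 1 := fun t ht x hx =>
    h.diag_pos ht.1 (hlt ht.2) hx
  have hsE : ∀ t ∈ Ico 0 T, ContDiffOn ℝ ∞ (fun y => g t y 1 1) (strip ρ) := fun t ht =>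
    h.slice ht.1 (hlt ht.2)
  have hsh : ∀ t ∈ Ico 0 T, ContDiffOn ℝ ∞ (fun y => (√(g t y 1 1))⁻¹) (strip ρ) := fun t ht =>
    contDiffOn_inv_sqrt (hsE t ht) (hpos t ht)
  have hsv : ∀ t ∈ Ico 0 T, ContDiffOn ℝ ∞ (conformalFactor f g t) (strip ρ) := fun t ht =>
    (hsh t ht).mul hf.contDiffOn_inv
  have hsub : Ico 0 T ×ˢ strip ρ ⊆ {p : ℝ × Coord | 0 ≤ p.1 ∧ (p.1 : EReal) < T' ∧ p.2 ∈ strip ρ} :=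
    fun p hp => ⟨hp.1.1, hlt hp.1.2, hp.2⟩
  have hc0 : ContinuousOn (fun p : ℝ × Coord => (√(g p.1 p.2 1 1))⁻¹) (Ico 0 T ×ˢ strip ρ) :=
    (((h.cont 1 1).mono hsub).sqrt).inv₀ fun p hp =>
      (Real.sqrt_pos.2 (hpos p.1 hp.1 p.2 hp.2)).ne'
  have hcpd : ∀ i, ContinuousOn (fun p : ℝ × Coord => pd ρ i (fun y => (√(g p.1 y 1 1))⁻¹) p.2)
      (Ico 0 T ×ˢ strip ρ) := fun i =>
    ((continuousOn_const.mul (hc0.pow 3)).mul ((h.cont_pd 1 1 i).mono hsub)).congr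
      fun p hp => pd_inv_sqrt hρ (hsE _ hp.1) (hpos _ hp.1) hp.2 i
  have hcpdpd : ∀ i, ContinuousOn
      (fun p : ℝ × Coord => pd ρ i (pd ρ i (fun y => (√(g p.1 y 1 1))⁻¹)) p.2)
      (Ico 0 T ×ˢ strip ρ) := fun i =>
    (((continuousOn_const.mul (hc0.pow 5)).mul (((h.cont_pd 1 1 i).mono hsub).pow 2)).sub
      ((continuousOn_const.mul (hc0.pow 3)).mul ((h.cont_pd_pd 1 1 i i).mono hsub))).congr
      fun p hp => pd_pd_inv_sqrt hρ (hsE _ hp.1) (hpos _ hp.1) hp.2 i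
  have hsnd : ∀ {w : Coord → ℝ}, ContDiffOn ℝ ∞ w (strip ρ) →
      ContinuousOn (fun p : ℝ × Coord => w p.2) (Ico 0 T ×ˢ strip ρ) := fun hw =>
    hw.continuousOn.comp continuous_snd.continuousOn fun _ hp => hp.2
  have hi := hf.contDiffOn_inv
  have hgeo : ∀ t ∈ Ioo 0 T, ∀ x ∈ strip ρ, x ∈ bdry ρ → x 1 ≠ 0 →
      sd ρ f (conformalFactor f g t) x = sd ρ f (fun x => (f (x 1))⁻¹) x := by
    intro t ht x hx hb hne
    have h1 := h.boundary t ht.1 (hlt ht.2) x hb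
    rw [(h.isConformal hf ht.1.le (hlt ht.2)).geodesicCurvature_eq hf (hsv t ⟨ht.1.le, ht.2⟩) hx,
      (isConformal_rotMetric hf).geodesicCurvature_eq hf hi hx] at h1
    refine mul_left_cancel₀ (neg_ne_zero.2 ?_) h1
    rcases lt_or_gt_of_ne hne with h' | h'
    · simp [Real.sign_of_neg h']
    · simp [Real.sign_of_pos h']
  refine ⟨hf, hT, hκ, ?_, ?_, ?_, ?_, ?_, ?_, ?_, ?_, ?_⟩
  · exact fun t ht x hx => (h.isConformal hf ht.1 (hlt ht.2) x hx).1
  · intro t ht x hx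
    simp [conformalFactor, (h.metric t ht.1 (hlt ht.2) x hx).2]
  · have h1 : ContDiffOn ℝ ∞ (fun p : ℝ × Coord => g p.1 p.2 1 1) (slab ρ T) :=
      (h.smooth 1 1).mono fun p hp => ⟨hp.1.1, hlt hp.1.2, hp.2⟩
    have h2 : ∀ p ∈ slab ρ T, 0 < g p.1 p.2 1 1 := fun p hp =>
      hpos p.1 ⟨hp.1.1.le, hp.1.2⟩ p.2 hp.2
    exact ((h1.sqrt fun p hp => (h2 p hp).ne').inv fun p hp => (Real.sqrt_pos.2 (h2 p hp)).ne').mul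
      (hi.comp (t := strip ρ) contDiff_snd.contDiffOn fun _ hp => hp.2)
  · exact hc0.mul (hsnd hi)
  · intro i
    refine (((hcpd i).mul (hsnd hi)).add (hc0.mul (hsnd (contDiffOn_pd hρ hi i)))).congr
      fun p hp => ?_
    exact pd_mul hρ hp.2 i ((hsh _ hp.1).differentiableOn (by simp) _ hp.2)
      (hi.differentiableOn (by simp) _ hp.2)
  · intro i
    refine ((((hcpdpd i).mul (hsnd hi)).add ((continuousOn_const (c := (2 : ℝ))).mul ((hcpd i).mul
      (hsnd (contDiffOn_pd hρ hi i))))).add (hc0.mul (hsnd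
        (contDiffOn_pd hρ (contDiffOn_pd hρ hi i) i)))).congr fun p hp => ?_
    exact pd_pd_mul hρ (hsh _ hp.1) hi hp.2 i
  · intro t ht x hx
    have ht' : t ∈ Ico 0 T := ⟨ht.1.le, ht.2⟩
    have h1 := (hasDerivAt_inv_sqrt (hpos t ht' x hx)).comp t (h.flow t ht.1 (hlt ht.2) x hx 1 1)
    have h2 := h1.mul_const ((f (x 1))⁻¹)
    rw [(h.isConformal hf ht.1.le (hlt ht.2)).scalarCurvature_eq hf (hsv t ht') hx] at h2
    have h3 := Real.sqrt_pos.2 (hpos t ht' x hx)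
    have h4 := Real.sq_sqrt (hpos t ht' x hx).le
    refine h2.congr_deriv ?_
    generalize pd ρ 0 (pd ρ 0 (conformalFactor f g t)) x +
      sd ρ f (sd ρ f (conformalFactor f g t)) x = L
    generalize pd ρ 0 (conformalFactor f g t) x ^ 2 + sd ρ f (conformalFactor f g t) x ^ 2 = G
    have h5 : (√(g t x 1 1))⁻¹ ^ 3 * g t x 1 1 = (√(g t x 1 1))⁻¹ := by
      nth_rewrite 2 [← h4]
      field_simp
    -- As `v` is a time-independent multiple of `g₁₁` to the power `-1/2`, the flow gives `v_t = (R
    -- / 2) v`; the curvature formula turns this into the scalar equation.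
    have h6 : ∀ r : ℝ, -(1 / 2) * (√(g t x 1 1))⁻¹ ^ 3 * (-r * g t x 1 1) * (f (x 1))⁻¹ =
        r / 2 * conformalFactor f g t x := by
      intro r
      calc _ = r / 2 * (((√(g t x 1 1))⁻¹ ^ 3 * g t x 1 1) * (f (x 1))⁻¹) := by ring
        _ = _ := by rw [h5]; rfl
    rw [h6]
    ring
  · intro t ht x hx
    refine ⟨fun e => ?_, fun e => ?_⟩
    · rw [hgeo t ht x hx (Or.inr e) (by rw [e]; exact hρ.ne'), (hbd x hx).1 e]
    · rw [hgeo t ht x hx (Or.inl e) (by rw [e]; linarith), (hbd x hx).2 e]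
  · intro x hx
    simp [conformalFactor, h.initial x hx, rotMetric]

end CylinderFlow

/-! ### The normalised flow and the decay of its curvature. -/

namespace CylinderFlow

variable {ρ κ : ℝ} {f : ℝ → ℝ}

theorem IsProfile.exists_pinch (hf : IsProfile ρ f) :
    ∃ a N, 0 < a ∧ 0 < N ∧ (∀ σ ∈ Icc (-ρ) ρ, a ≤ f σ) ∧ ∀ σ ∈ Icc (-ρ) ρ, f σ ≤ N := by
  have hne : (Icc (-ρ) ρ).Nonempty := nonempty_Icc.2 (by linarith [hf.rho_pos])
  obtain ⟨σ₁, h₁, hm⟩ := isCompact_Icc.exists_isMinOn hne hf.smooth.continuousOn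
  obtain ⟨σ₂, h₂, hM⟩ := isCompact_Icc.exists_isMaxOn hne hf.smooth.continuousOn
  exact ⟨f σ₁, f σ₂, hf.pos _ h₁, hf.pos _ h₂, fun σ hσ => hm hσ, fun σ hσ => hM hσ⟩

/-- Bounds for the initial gradient and second derivative. -/
theorem IsProfile.exists_initial_bound (hf : IsProfile ρ f) :
    ∃ C W, 0 < C ∧ 0 < W ∧ (∀ x ∈ strip ρ, |sd ρ f (fun x => (f (x 1))⁻¹) x| ≤ C) ∧
      ∀ x ∈ strip ρ, |sd ρ f (sd ρ f (fun x => (f (x 1))⁻¹)) x| ≤ W := by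
  have hi := hf.contDiffOn_inv
  have hper : ∀ x ∈ strip ρ, (f ((x + (Pi.single 0 (2 * Real.pi) : Coord)) 1))⁻¹ = (f (x 1))⁻¹ :=
    fun x _ => by simp
  have key : ∀ w : Coord → ℝ, ContDiffOn ℝ ∞ w (strip ρ) →
      (∀ x ∈ strip ρ, w (x + Pi.single 0 (2 * Real.pi)) = w x) →
      ∃ C, 0 < C ∧ ∀ x ∈ strip ρ, |w x| ≤ C := by
    intro w hw hp
    obtain ⟨C, hC0, hC⟩ := exists_bound_of_continuousOn (ρ := ρ) (a := 0) (b := 0)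
      (z := fun _ => w) (hw.continuousOn.comp continuous_snd.continuousOn fun _ hp => hp.2)
      (fun _ _ => hp)
    exact ⟨C, hC0, hC 0 ⟨le_rfl, le_rfl⟩⟩
  obtain ⟨C, hC0, hC⟩ := key _ (hf.contDiffOn_sd hi) (sd_periodic hper)
  obtain ⟨W, hW0, hW⟩ := key _ (hf.contDiffOn_sd (hf.contDiffOn_sd hi))
    (sd_periodic (sd_periodic hper))
  exact ⟨C, W, hC0, hW0, hC, hW⟩

theorem IsSol.sd_zero_eq {T : ℝ} {v : ℝ → Coord → ℝ} (h : IsSol ρ T κ f v) {x : Coord}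
    (hx : x ∈ strip ρ) : sd ρ f (v 0) x = sd ρ f (fun x => (f (x 1))⁻¹) x :=
  IsProfile.sd_congr h.init hx

/-- Scalar curvature of a constant multiple of a solution. -/
theorem IsSol.scalarCurvature_smul {T : ℝ} {v : ℝ → Coord → ℝ} (h : IsSol ρ T κ f v) {t : ℝ}
    (ht : t ∈ Ico 0 T) {g g' : TensorField} (hg' : IsConformal ρ f (v t) g') {A : ℝ} (hA : 0 < A)
    (hg : ∀ x ∈ strip ρ, g x = (1 / A) • g' x) {x : Coord} (hx : x ∈ strip ρ) :
    scalarCurvature ρ g x =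
      A * (2 * (v t x * sd ρ f (sd ρ f (v t)) x - sd ρ f (v t) x ^ 2)) := by
  have hf := h.profile
  have s0 := h.slice ht
  have hs := Real.sqrt_pos.2 hA
  have hss := Real.sq_sqrt hA.le
  have cs : ContDiffOn ℝ ∞ (fun _ : Coord => √A) (strip ρ) := contDiffOn_const
  -- Dividing the metric by `A` multiplies `v` by `√A`, and the curvature is quadratic in `v`.
  have hc : IsConformal ρ f (fun y => √A * v t y) g := by
    intro y hy
    refine ⟨mul_pos hs (hg' y hy).1, ?_⟩
    rw [hg y hy, (hg' y hy).2]
    ext i j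
    fin_cases i <;> fin_cases j <;> simp [mul_pow, hss] <;> ring
  have D : ∀ w : Coord → ℝ, ContDiffOn ℝ ∞ w (strip ρ) → ∀ y ∈ strip ρ,
      sd ρ f (fun y => √A * w y) y = √A * sd ρ f w y := by
    intro w hw y hy
    rw [hf.sd_mul cs hw hy, sd, pd_const]; ring
  have Z : ∀ y ∈ strip ρ, pd ρ 0 (fun y => √A * v t y) y = 0 := by
    intro y hy
    rw [pd_mul hf.rho_pos hy 0 (cs.differentiableOn (by simp) y hy)
      (s0.differentiableOn (by simp) y hy), pd_const, h.pd_zero ht hy]; ring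
  rw [hc.scalarCurvature_eq hf (cs.mul s0) hx, Z x hx,
    pd_congr (w := fun _ => 0) (fun y hy => Z y hy) hx, pd_const,
    IsProfile.sd_congr (D _ s0) hx, D _ (hf.contDiffOn_sd s0) x hx, D _ s0 x hx]
  calc _ = √A ^ 2 * (2 * (v t x * sd ρ f (sd ρ f (v t)) x - sd ρ f (v t) x ^ 2)) := by ring
    _ = _ := by rw [hss]

/-- The normalised time is controlled by a bound of the conformal factor. -/
theorem normTime_le {g : ℝ → TensorField} {t K : ℝ} (ht : 0 ≤ t)
    (hA : ∀ τ ∈ Icc 0 t, 0 < area ρ (g τ) ∧ 1 / area ρ (g τ) ≤ K) :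
    normTime ρ g t ≤ K * t := by
  have h1 := intervalIntegral.norm_integral_le_of_norm_le_const (a := 0) (b := t) (C := K)
    (f := normFactor ρ g) fun τ hτ => by
      rw [uIoc_of_le ht] at hτ
      obtain ⟨h2, h3⟩ := hA τ ⟨hτ.1.le, hτ.2⟩
      rw [normFactor, Real.norm_eq_abs, abs_of_pos (by positivity)]
      exact h3
  rw [sub_zero, abs_of_nonneg ht] at h1
  exact (le_abs_self _).trans h1

/-- If `v` is below `V` somewhere at time `t`, growth bounds `t`, and at all earlier times the
oscillation bound keeps `v` below a fixed constant. The area is then bounded below on `[0, t]`, and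
so the normalised time is bounded. -/
theorem le_of_normTime {T' : EReal} {g : ℝ → TensorField}
    (h : IsRicciFlow ρ (rotMetric f) T' g) (hf : IsProfile ρ f) {C a N c M : ℝ} (ha : 0 < a)
    (hN : 0 < N) (hC : 0 < C) (hc : 0 < c) (hfN : ∀ σ ∈ Icc (-ρ) ρ, f σ ≤ N)
    (hsol : ∀ T : ℝ, 0 < T → (T : EReal) < T' → IsSol ρ T κ f (conformalFactor f g))
    (hosc : ∀ t : ℝ, 0 ≤ t → (t : EReal) < T' → ∀ x ∈ strip ρ, ∀ y ∈ strip ρ,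
      conformalFactor f g t x - conformalFactor f g t y ≤ C / a * (2 * ρ))
    (hgrow : ∀ t : ℝ, 0 ≤ t → (t : EReal) < T' → ∀ x ∈ strip ρ,
      c * t - M ≤ conformalFactor f g t x) {V : ℝ} (hV : 0 < V) :
    ∃ B : ℝ, ∀ t : ℝ, 0 ≤ t → (t : EReal) < T' → B < normTime ρ g t →
      ∀ x ∈ strip ρ, V ≤ conformalFactor f g t x := by
  have hρ := hf.rho_pos
  set V' := V + C / a * (2 * ρ) with hV'
  have hV'0 : 0 < V' := by positivity
  set K := (4 * Real.pi * ρ / (V' ^ 2 * N))⁻¹ with hK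
  have hK0 : 0 < K := by positivity
  refine ⟨K * ((V + M) / c), fun t ht htT hB x₀ hx₀ => ?_⟩
  by_contra hcon
  push Not at hcon
  have h1 : t ≤ (V + M) / c := by
    rw [le_div_iff₀ hc]
    linarith [hgrow t ht htT x₀ hx₀]
  obtain ⟨T, hT1, hT2⟩ := EReal.lt_iff_exists_real_btwn.1 htT
  have hT1' : t < T := EReal.coe_lt_coe_iff.1 hT1
  have hS := hsol T (ht.trans_lt hT1') hT2
  have h2 := normTime_le (ρ := ρ) (g := g) (K := K) ht fun τ hτ => by
    have hτT : (τ : EReal) < T' := lt_of_le_of_lt (EReal.coe_le_coe_iff.2 hτ.2) htT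
    have hτI : τ ∈ Ico 0 T := ⟨hτ.1, hτ.2.trans_lt hT1'⟩
    -- Were `v ≥ V` everywhere at time `τ`, monotonicity of the minimum would preserve it up to `t`,
    -- against the choice of `x₀`.
    obtain ⟨y, hy, hyV⟩ : ∃ y ∈ strip ρ, conformalFactor f g τ y < V := by
      by_contra hc'
      push Not at hc'
      exact absurd (hS.mono_min hτ.1 hτ.2 hT1' hc' x₀ hx₀) (not_le.2 hcon)
    have h3 := hS.le_area hτI (h.isConformal hf hτ.1 hτT) hV'0 hN
      (fun x hx => by linarith [hosc τ hτ.1 hτT x hx y hy]) hfN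
    have h4 : 0 < 4 * Real.pi * ρ / (V' ^ 2 * N) := by positivity
    refine ⟨h4.trans_le h3, ?_⟩
    rw [one_div, hK]
    exact inv_anti₀ h4 h3
  have h3 := mul_le_mul_of_nonneg_left h1 hK0.le
  linarith

/-- The scalar curvature of a normalised flow tends to zero uniformly. -/
theorem exists_scalarCurvature_lt (hf : IsProfile ρ f)
    (heven : ∀ σ ∈ Icc (-ρ) ρ, f (-σ) = f σ)
    (hR : ∀ x ∈ strip ρ, 0 ≤ scalarCurvature ρ (rotMetric f) x)
    {g : ℝ → TensorField} (hg : IsNormalisedFlow ρ (rotMetric f) g) {ε : ℝ} (hε : 0 < ε) :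
    ∃ t₀ : ℝ, ∀ t, 0 ≤ t → t₀ < t → ∀ x ∈ strip ρ, |scalarCurvature ρ (g t) x| < ε := by
  have hρ := hf.rho_pos
  obtain ⟨T', g', h, htime⟩ := hg
  obtain ⟨κ, hκ, hbd, hflat⟩ := hf.boundary_sign heven hR
  obtain ⟨a, N, ha, hN, hfa, hfN⟩ := hf.exists_pinch
  obtain ⟨C₀, W₀, hC₀, hW₀, hC₀b, hW₀b⟩ := hf.exists_initial_bound
  set v := conformalFactor f g' with hv
  have hsol : ∀ T : ℝ, 0 < T → (T : EReal) < T' → IsSol ρ T κ f v := fun T hT hTT' =>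
    h.isSol hf hκ hbd hT hTT'
  have hsol' : ∀ t : ℝ, 0 ≤ t → (t : EReal) < T' → ∃ T, t < T ∧ IsSol ρ T κ f v := by
    intro t ht htT
    obtain ⟨T, hT1, hT2⟩ := EReal.lt_iff_exists_real_btwn.1 htT
    have hT1' : t < T := EReal.coe_lt_coe_iff.1 hT1
    exact ⟨T, hT1', hsol T (ht.trans_lt hT1') hT2⟩
  have hvpos : ∀ t : ℝ, 0 ≤ t → (t : EReal) < T' → ∀ x ∈ strip ρ, 0 < v t x := by
    intro t ht htT
    obtain ⟨T, hT, hS⟩ := hsol' t ht htT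
    exact hS.pos t ⟨ht, hT⟩
  -- For `κ = 0` there is no growth to use, but the gradient bound holds with constant `0`, so the
  -- metric stays flat.
  rcases eq_or_lt_of_le hκ with hκ0 | hκ0
  · refine ⟨0, fun t ht _ x hx => ?_⟩
    obtain ⟨t', ht', htT', -, hgt⟩ := htime t ht
    obtain ⟨T, hT, hS⟩ := hsol' t' ht' htT'
    have hI : t' ∈ Ico 0 T := ⟨ht', hT⟩
    have hz : ∀ y ∈ strip ρ, sd ρ f (v t') y = 0 := fun y hy => by
      have := hS.abs_sd_le (C := 0) hκ0.ge (fun z hz => by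
        rw [hS.sd_zero_eq hz, hflat hκ0.symm z hz, abs_zero]) hI y hy
      exact abs_nonpos_iff.1 this
    have hz2 : sd ρ f (sd ρ f (v t')) x = 0 := by
      rw [IsProfile.sd_congr (w := fun _ => 0) hz hx, sd, pd_const, mul_zero]
    obtain ⟨V, hV0, hV⟩ := IsSol.exists_bound hI hS.cont hS.per
    have hA := hS.le_area hI (h.isConformal hf ht' htT') hV0 hN
      (fun y hy => (le_abs_self _).trans (hV t' ⟨ht', le_rfl⟩ y hy)) hfN
    have hA0 : 0 < area ρ (g' t') := lt_of_lt_of_le (by positivity) hA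
    rw [hS.scalarCurvature_smul hI (h.isConformal hf ht' htT') hA0 hgt hx, hz x hx, hz2]
    simpa using hε
  · obtain ⟨c, M, hc, hgrow⟩ := hf.exists_growth hκ0
    set C := max κ C₀ with hC
    have hC0 : 0 < C := lt_max_of_lt_left hκ0
    set m := N⁻¹ with hm
    have hm0 : 0 < m := inv_pos.2 hN
    set W := W₀ + 2 * κ ^ 2 / m with hW
    have hW0 : 0 < W := by positivity
    have hp : ∀ t : ℝ, 0 ≤ t → (t : EReal) < T' → ∀ x ∈ strip ρ, |sd ρ f (v t) x| ≤ C := by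
      intro t ht htT
      obtain ⟨T, hT, hS⟩ := hsol' t ht htT
      exact hS.abs_sd_le (le_max_left _ _) (fun x hx => by
        rw [hS.sd_zero_eq hx]; exact (hC₀b x hx).trans (le_max_right _ _)) ⟨ht, hT⟩
    have hw : ∀ t : ℝ, 0 ≤ t → (t : EReal) < T' → ∀ x ∈ strip ρ,
        |sd ρ f (sd ρ f (v t)) x| ≤ W := by
      intro t ht htT
      obtain ⟨T, hT, hS⟩ := hsol' t ht htT
      exact hS.abs_sd_sd_le hm0 (fun x hx => by
        rw [hS.init x hx]; exact inv_anti₀ (hf.pos' hx) (hfN _ hx)) (fun x hx => by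
        rw [IsProfile.sd_congr (fun y hy => hS.sd_zero_eq hy) hx]; exact hW₀b x hx) ⟨ht, hT⟩
    have hosc : ∀ t : ℝ, 0 ≤ t → (t : EReal) < T' → ∀ x ∈ strip ρ, ∀ y ∈ strip ρ,
        v t x - v t y ≤ C / a * (2 * ρ) := by
      intro t ht htT
      obtain ⟨T, hT, hS⟩ := hsol' t ht htT
      exact hS.sub_le ha hfa ⟨ht, hT⟩ (hp t ht htT)
    set D := C / a * (2 * ρ) with hD
    have hD0 : 0 < D := by positivity
    -- `Q / z` is the product of the area bound with `v ≥ z / 2` and the curvature bound `2 (W + C²)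
    -- z`, where `z` is the value of `v` at the given point.
    set Q := 4 * Real.pi * ρ * 4 / a * (2 * (W + C ^ 2)) with hQ
    have hQ0 : 0 < Q := by positivity
    -- The three entries serve, in order, to absorb `C²` into `C² z`, to get `v ≥ z / 2` everywhere
    -- from the oscillation bound `D`, and to make `Q / z ≤ ε / 2`.
    set V := max 1 (max (2 * D) (2 * Q / ε)) with hVdef
    have hV1 : 1 ≤ V := le_max_left _ _
    have hV2 : 2 * D ≤ V := (le_max_left _ _).trans (le_max_right _ _)
    have hV3 : 2 * Q / ε ≤ V := (le_max_right _ _).trans (le_max_right _ _)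
    obtain ⟨B, hB⟩ := le_of_normTime h hf ha hN hC0 hc hfN hsol hosc
      (fun t ht htT => by
        obtain ⟨T, hT, hS⟩ := hsol' t ht htT
        exact hgrow T v hS t ⟨ht, hT⟩) (V := V) (by linarith)
    refine ⟨B, fun t ht htB x hx => ?_⟩
    obtain ⟨t', ht', htT', htn, hgt⟩ := htime t ht
    obtain ⟨T, hT, hS⟩ := hsol' t' ht' htT'
    have hI : t' ∈ Ico 0 T := ⟨ht', hT⟩
    have hcf := h.isConformal hf ht' htT'
    have hVx : V ≤ v t' x := hB t' ht' htT' (by rw [htn]; exact htB) x hx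
    set z := v t' x with hz
    have hz1 : 1 ≤ z := hV1.trans hVx
    have hlow : ∀ y ∈ strip ρ, z / 2 ≤ v t' y := fun y hy => by
      have := hosc t' ht' htT' x hx y hy
      linarith
    have hup : ∀ y ∈ strip ρ, v t' y ≤ z + D := fun y hy => by
      have := hosc t' ht' htT' y hy x hx
      linarith
    have hA0 : 0 < area ρ (g' t') :=
      lt_of_lt_of_le (by positivity) (hS.le_area hI hcf (show 0 < z + D by linarith) hN hup hfN)
    have hA := hS.area_le hI hcf (show 0 < z / 2 by linarith) ha hlow hfa
    rw [hS.scalarCurvature_smul hI hcf hA0 hgt hx, abs_mul, abs_of_pos hA0, ← hz]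
    have hp1 := hp t' ht' htT' x hx
    have hw1 := hw t' ht' htT' x hx
    set p := sd ρ f (v t') x
    set w := sd ρ f (sd ρ f (v t')) x
    have e1 : |2 * (z * w - p ^ 2)| ≤ 2 * (W + C ^ 2) * z := by
      rw [abs_mul, abs_two, mul_assoc]
      refine mul_le_mul_of_nonneg_left ?_ zero_le_two
      have i1 : |z * w| ≤ z * W := by
        rw [abs_mul, abs_of_pos (by linarith : 0 < z)]
        exact mul_le_mul_of_nonneg_left hw1 (by linarith)
      have i2 : |p ^ 2| ≤ C ^ 2 := by
        rw [abs_pow]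
        exact pow_le_pow_left₀ (abs_nonneg _) hp1 2
      have i3 := abs_sub (z * w) (p ^ 2)
      have i4 : C ^ 2 ≤ C ^ 2 * z := le_mul_of_one_le_right (sq_nonneg _) hz1
      linarith
    have e2 : area ρ (g' t') * |2 * (z * w - p ^ 2)| ≤ Q / z := by
      refine (mul_le_mul hA e1 (abs_nonneg _) (by positivity)).trans (le_of_eq ?_)
      have : z ≠ 0 := by linarith
      rw [hQ]
      field_simp
      ring
    refine e2.trans_lt ?_
    rw [div_lt_iff₀ (by linarith)]
    rw [div_le_iff₀ hε] at hV3
    nlinarith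

end CylinderFlow

theorem mainTheorem7 (ρ : ℝ) (hρ : 0 < ρ) (f : ℝ → ℝ)
    (hf_smooth : ContDiffOn ℝ ∞ f (Icc (-ρ) ρ))
    (hf_pos : ∀ σ ∈ Icc (-ρ) ρ, 0 < f σ)
    (hf_even : ∀ σ ∈ Icc (-ρ) ρ, f (-σ) = f σ)
    (hR_nonneg : ∀ x ∈ CylinderFlow.strip ρ,
      0 ≤ CylinderFlow.scalarCurvature ρ (CylinderFlow.rotMetric f) x)
    (hR_decreasing : ∀ x ∈ CylinderFlow.strip ρ, ∀ y ∈ CylinderFlow.strip ρ, |x 1| ≤ |y 1| →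
      CylinderFlow.scalarCurvature ρ (CylinderFlow.rotMetric f) y ≤
        CylinderFlow.scalarCurvature ρ (CylinderFlow.rotMetric f) x)
    (g : ℝ → CylinderFlow.TensorField)
    (hg : CylinderFlow.IsNormalisedFlow ρ (CylinderFlow.rotMetric f) g) :
    ∃ t : ℕ → ℝ, (∀ k, 0 ≤ t k) ∧ Tendsto t atTop atTop ∧
      TendstoUniformlyOn (fun k x => CylinderFlow.scalarCurvature ρ (g (t k)) x)
        (fun _ => (0 : ℝ)) atTop (CylinderFlow.strip ρ) := by
  refine ⟨fun k => k, fun k => k.cast_nonneg, tendsto_natCast_atTop_atTop, ?_⟩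
  rw [Metric.tendstoUniformlyOn_iff]
  intro ε hε
  obtain ⟨t₀, ht₀⟩ :=
    CylinderFlow.exists_scalarCurvature_lt ⟨hρ, hf_smooth, hf_pos⟩ hf_even hR_nonneg hg hε
  filter_upwards [tendsto_natCast_atTop_atTop.eventually (eventually_gt_atTop t₀)] with k hk x hx
  rw [dist_zero_left, Real.norm_eq_abs]
  exact ht₀ k k.cast_nonneg hk x hx
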